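/- Let $N\ge 1$ be an integer, $\varepsilon>0$, $A_k\in\mathbb R^{n\times n}$ and $B_k\in\mathbb R^{n\times m}$ for $k\in\{0,\dots,N-1\}$, and let $\bar\Sigma_0,\bar\Sigma_N\in\mathbb R^{n\times n}$ be symmetric positive definite. **Problem.** A policy is a family $\pi=\{\pi_k\}_{k=0}^{N-1}$ of (jointly measurable) conditional probability densities $\pi_k(u|x)$, $x\in\mathbb R^n$, $u\in\mathbb R^m$. The MaxEnt optimal density control problem is $$\text{minimize}_{\pi}\quad \mathbb E\Big[\sum_{k=0}^{N-1}\Big(\tfrac12\|u_k\|^2-\varepsilon\,\mathrm H(\pi_k(\cdot|x_k))\Big)\Big],\qquad \mathrm H(p)=-\int_{\mathbb R^m}p\log p\,\mathrm du,$$ subject to $x_{k+1}=A_kx_k+B_ku_k$, $u_k\sim\pi_k(\cdot|x)$ given $x_k=x$, $x_0\sim\mathcal N(0,\bar\Sigma_0)$ and $x_N\sim\mathcal N(0,\bar\Sigma_N)$. The cost takes values in $(-\infty,+\infty]$: it is $+\infty$ when $\mathbb E\|u_k\|^2$ or the (expected) entropy $\mathrm H(\pi_k(\cdot|x_k))$ is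 not finite for some $k$. **Notation.** If the $A_k$ are invertible, put $\Phi(k,l)=A_{k-1}\cdots A_l$ for $k>l$, $\Phi(k,k)=I$, $\Phi(k,l)=A_k^{-1}\cdots A_{l-1}^{-1}$ for $k<l$, and, for $k_0<k_1$, $$G_{\rm r}(k_1,k_0)=\sum_{k=k_0}^{k_1-1}\Phi(k_1,k+1)B_kB_k^\top\Phi(k_1,k+1)^\top,\qquad G_{\rm c}(k_1,k_0)=\sum_{k=k_0}^{k_1-1}\Phi(k_0,k+1)B_kB_k^\top\Phi(k_0,k+1)^\top .$$ With $G_{\rm c}=G_{\rm c}(N,0)$ and $M^{1/2}$ the positive semidefinite square root, let $$S_0=\tfrac1\varepsilon G_{\rm c}^{-1/2}\bar\Sigma_0G_{\rm c}^{-1/2},\qquad S_N=\tfrac1\varepsilon G_{\rm c}^{-1/2}\Phi(0,N)\bar\Sigma_N\Phi(0,N)^\top G_{\rm c}^{-1/2},$$ $$\mathcal F(S_0,S_N)=S_0+\tfrac12I-\big(S_0^{1/2}S_NS_0^{1/2}+\tfrac14I\big)^{1/2},\qquad \mathcal B(S_0,S_N)=-S_0+\tfrac12I+\big(S_0^{1/2}S_NS_0^{1/2}+\tfrac14I\big)^{1/2}.$$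 **Theorem.** Assume that every $A_k$, $0\le k\le N-1$, is invertible; that there is $k_{\rm r}\in\{1,\dots,N\}$ such that $G_{\rm r}(k,0)$ is invertible for all $k\in\{k_{\rm r},\dots,N\}$ and $G_{\rm r}(N,k)$ is invertible for all $k\in\{0,\dots,k_{\rm r}-1\}$; and that $\mathcal F(S_0,S_N)$ and $\mathcal B(S_0,S_N)$ are invertible. Define $Q_{-,k}$ by $$Q_{-,0}=G_{\rm c}^{1/2}S_0^{1/2}\,\mathcal F(S_0,S_N)^{-1}S_0^{1/2}G_{\rm c}^{1/2},\qquad Q_{-,k+1}=A_kQ_{-,k}A_k^\top-B_kB_k^\top\quad(0\le k\le N-1).$$ Then $Q_{-,k}$ is invertible for $0\le k\le N$, $I+B_k^\top Q_{-,k+1}^{-1}B_k$ is positive definite for $0\le k\le N-1$, and the policy whose density $\pi_k^*(\cdot|x)$ is that of $$\mathcal N\Big(-(I+B_k^\top Q_{-,k+1}^{-1}B_k)^{-1}B_k^\top Q_{-,k+1}^{-1}A_kx,\ \varepsilon(I+B_k^\top Q_{-,k+1}^{-1}B_k)^{-1}\Big),\quad 0\le k\le N-1,\ x\in\mathbb R^n,$$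 is optimal for the MaxEnt optimal density control problem, with finite cost. It is the unique optimal policy: every optimal policy $\pi$ satisfies, for each $k\in\{0,\dots,N-1\}$ and Lebesgue-almost every $x$, $\pi_k(u|x)=\pi_k^*(u|x)$ for Lebesgue-almost every $u$. -/

import Mathlib

open MeasureTheory ProbabilityTheory Finset Matrix
open scoped ENNReal MatrixOrder

noncomputable section

namespace DensityControl

/-! ### The linear system: transition matrices, Gramians, the matrices `F`, `B` and `Q₋` -/

section LinearSystem

variable {n m : ℕ}

/-- `transFwd A l j = A (l+j-1) * ⋯ * A l`. -/
def transFwd (A : ℕ → Matrix (Fin n) (Fin n) ℝ) (l : ℕ) : ℕ → Matrix (Fin n) (Fin n) ℝ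
  | 0 => 1
  | j + 1 => A (l + j) * transFwd A l j

/-- `transBwd A k j = (A k)⁻¹ * ⋯ * (A (k+j-1))⁻¹`. -/
def transBwd (A : ℕ → Matrix (Fin n) (Fin n) ℝ) (k : ℕ) : ℕ → Matrix (Fin n) (Fin n) ℝ
  | 0 => 1
  | j + 1 => transBwd A k j * (A (k + j))⁻¹

/-- The state-transition matrix `Φ(k, l)`. -/
def transition (A : ℕ → Matrix (Fin n) (Fin n) ℝ) (k l : ℕ) : Matrix (Fin n) (Fin n) ℝ :=
  if l ≤ k then transFwd A l (k - l) else transBwd A k (l - k)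

/-- The reachability Gramian `G_r(k₁, k₀)`. -/
def reachGramian (A : ℕ → Matrix (Fin n) (Fin n) ℝ) (B : ℕ → Matrix (Fin n) (Fin m) ℝ)
    (k₁ k₀ : ℕ) : Matrix (Fin n) (Fin n) ℝ :=
  ∑ k ∈ Finset.Ico k₀ k₁,
    transition A k₁ (k + 1) * B k * (B k)ᵀ * (transition A k₁ (k + 1))ᵀ

/-- The controllability Gramian `G_c(k₁, k₀)`. -/
def ctrlGramian (A : ℕ → Matrix (Fin n) (Fin n) ℝ) (B : ℕ → Matrix (Fin n) (Fin m) ℝ)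
    (k₁ k₀ : ℕ) : Matrix (Fin n) (Fin n) ℝ :=
  ∑ k ∈ Finset.Ico k₀ k₁,
    transition A k₀ (k + 1) * B k * (B k)ᵀ * (transition A k₀ (k + 1))ᵀ

/-- `S₀ = ε⁻¹ G_c(N,0)^{-1/2} Σ₀ G_c(N,0)^{-1/2}`; `CFC.sqrt` is the positive semidefinite
square root of a positive semidefinite matrix. -/
def scaledInit (A : ℕ → Matrix (Fin n) (Fin n) ℝ) (B : ℕ → Matrix (Fin n) (Fin m) ℝ)
    (N : ℕ) (ε : ℝ) (Sig₀ : Matrix (Fin n) (Fin n) ℝ) : Matrix (Fin n) (Fin n) ℝ :=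
  ε⁻¹ • ((CFC.sqrt (ctrlGramian A B N 0))⁻¹ * Sig₀ * (CFC.sqrt (ctrlGramian A B N 0))⁻¹)

/-- `S_N = ε⁻¹ G_c(N,0)^{-1/2} Φ(0,N) Σ_N Φ(0,N)ᵀ G_c(N,0)^{-1/2}`. -/
def scaledFinal (A : ℕ → Matrix (Fin n) (Fin n) ℝ) (B : ℕ → Matrix (Fin n) (Fin m) ℝ)
    (N : ℕ) (ε : ℝ) (SigN : Matrix (Fin n) (Fin n) ℝ) : Matrix (Fin n) (Fin n) ℝ :=
  ε⁻¹ • ((CFC.sqrt (ctrlGramian A B N 0))⁻¹ *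
    (transition A 0 N * SigN * (transition A 0 N)ᵀ) * (CFC.sqrt (ctrlGramian A B N 0))⁻¹)

/-- `(S₀^{1/2} S_N S₀^{1/2} + I/4)^{1/2}`. -/
def midRoot (S₀ SN : Matrix (Fin n) (Fin n) ℝ) : Matrix (Fin n) (Fin n) ℝ :=
  CFC.sqrt (CFC.sqrt S₀ * SN * CFC.sqrt S₀ + (1 / 4 : ℝ) • (1 : Matrix (Fin n) (Fin n) ℝ))

/-- `F(S₀, S_N) = S₀ + I/2 - (S₀^{1/2} S_N S₀^{1/2} + I/4)^{1/2}`. -/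
def calF (S₀ SN : Matrix (Fin n) (Fin n) ℝ) : Matrix (Fin n) (Fin n) ℝ :=
  S₀ + (1 / 2 : ℝ) • (1 : Matrix (Fin n) (Fin n) ℝ) - midRoot S₀ SN

/-- `B(S₀, S_N) = -S₀ + I/2 + (S₀^{1/2} S_N S₀^{1/2} + I/4)^{1/2}`. -/
def calB (S₀ SN : Matrix (Fin n) (Fin n) ℝ) : Matrix (Fin n) (Fin n) ℝ :=
  -S₀ + (1 / 2 : ℝ) • (1 : Matrix (Fin n) (Fin n) ℝ) + midRoot S₀ SN

/-- The initial value `Q₋,₀ = G_c^{1/2} S₀^{1/2} F(S₀, S_N)⁻¹ S₀^{1/2} G_c^{1/2}`, with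
`G_c = G_c(N,0)`. -/
def QminusInit (A : ℕ → Matrix (Fin n) (Fin n) ℝ) (B : ℕ → Matrix (Fin n) (Fin m) ℝ)
    (N : ℕ) (ε : ℝ) (Sig₀ SigN : Matrix (Fin n) (Fin n) ℝ) : Matrix (Fin n) (Fin n) ℝ :=
  let S₀ := scaledInit A B N ε Sig₀
  let SN := scaledFinal A B N ε SigN
  let G := ctrlGramian A B N 0
  CFC.sqrt G * CFC.sqrt S₀ *
    (S₀ + (1 / 2 : ℝ) • (1 : Matrix (Fin n) (Fin n) ℝ) - midRoot S₀ SN)⁻¹ *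
    CFC.sqrt S₀ * CFC.sqrt G

/-- `Q₋,ₖ`: the solution of `Q (k+1) = A k * Q k * (A k)ᵀ - B k * (B k)ᵀ` that starts from
`Q₋,₀`. -/
def Qminus (A : ℕ → Matrix (Fin n) (Fin n) ℝ) (B : ℕ → Matrix (Fin n) (Fin m) ℝ)
    (N : ℕ) (ε : ℝ) (Sig₀ SigN : Matrix (Fin n) (Fin n) ℝ) : ℕ → Matrix (Fin n) (Fin n) ℝ
  | 0 => QminusInit A B N ε Sig₀ SigN
  | k + 1 => A k * Qminus A B N ε Sig₀ SigN k * (A k)ᵀ - B k * (B k)ᵀ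

end LinearSystem

/-! ### Policies, controlled process, cost -/

section Control

variable {n m : ℕ}

/-- The density of the Gaussian distribution on `ℝᵐ` with mean `μ` and (positive definite)
covariance matrix `S`. -/
def gaussianDensity (μ : EuclideanSpace ℝ (Fin m)) (S : Matrix (Fin m) (Fin m) ℝ)
    (u : EuclideanSpace ℝ (Fin m)) : ℝ :=
  (Real.sqrt ((2 * Real.pi) ^ m * S.det))⁻¹ *
    Real.exp (-(1 / 2 : ℝ) * ((u - μ).ofLp ⬝ᵥ (S⁻¹ *ᵥ (u - μ).ofLp)))

/-- A stochastic policy over the stages `0, …, N-1`: at each stage `k` a (jointly measurable)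
conditional probability density `π k x` of the control given the state `x`. The entries of `π`
at stages `k ≥ N` play no role. -/
structure IsPolicy (N : ℕ)
    (π : ℕ → EuclideanSpace ℝ (Fin n) → EuclideanSpace ℝ (Fin m) → ℝ) : Prop where
  measurable : ∀ k < N, Measurable (Function.uncurry (π k))
  nonneg : ∀ k < N, ∀ x u, 0 ≤ π k x u
  lintegral_eq_one : ∀ k < N, ∀ x, ∫⁻ u, ENNReal.ofReal (π k x u) = 1

/-- The joint law of `(x, u)` when `x` has law `ν` and `u` has conditional density `p x`
given `x`. -/
def jointLaw (ν : Measure (EuclideanSpace ℝ (Fin n)))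
    (p : EuclideanSpace ℝ (Fin n) → EuclideanSpace ℝ (Fin m) → ℝ) :
    Measure (EuclideanSpace ℝ (Fin n) × EuclideanSpace ℝ (Fin m)) :=
  (ν.prod volume).withDensity fun z => ENNReal.ofReal (p z.1 z.2)

/-- The law of the state `x_k` of `x_{k+1} = A_k x_k + B_k u_k`, where `u_k` has conditional
density `π k x` given `x_k = x`, and `x_0` has law `ν`. -/
def stateLaw (A : ℕ → Matrix (Fin n) (Fin n) ℝ) (B : ℕ → Matrix (Fin n) (Fin m) ℝ)
    (ν : Measure (EuclideanSpace ℝ (Fin n)))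
    (π : ℕ → EuclideanSpace ℝ (Fin n) → EuclideanSpace ℝ (Fin m) → ℝ) :
    ℕ → Measure (EuclideanSpace ℝ (Fin n))
  | 0 => ν
  | k + 1 => (jointLaw (stateLaw A B ν π k) (π k)).map
      fun z => Matrix.toEuclideanLin (A k) z.1 + Matrix.toEuclideanLin (B k) z.2

/-- The joint law of `(x_k, u_k)`. -/
def stageLaw (A : ℕ → Matrix (Fin n) (Fin n) ℝ) (B : ℕ → Matrix (Fin n) (Fin m) ℝ)
    (ν : Measure (EuclideanSpace ℝ (Fin n)))
    (π : ℕ → EuclideanSpace ℝ (Fin n) → EuclideanSpace ℝ (Fin m) → ℝ) (k : ℕ) :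
    Measure (EuclideanSpace ℝ (Fin n) × EuclideanSpace ℝ (Fin m)) :=
  jointLaw (stateLaw A B ν π k) (π k)

/-- The (differential) entropy `H(p) = -∫ p log p` of a density. -/
def entropy (p : EuclideanSpace ℝ (Fin m) → ℝ) : ℝ :=
  -∫ u, p u * Real.log (p u)

/-- All the integrals in the cost exist and are finite: finite control energy, finite entropy
of `π_k(·|x)` for almost every value `x` of `x_k`, and finite expected entropy. -/
structure HasFiniteCost (A : ℕ → Matrix (Fin n) (Fin n) ℝ) (B : ℕ → Matrix (Fin n) (Fin m) ℝ)
    (N : ℕ) (ν : Measure (EuclideanSpace ℝ (Fin n)))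
    (π : ℕ → EuclideanSpace ℝ (Fin n) → EuclideanSpace ℝ (Fin m) → ℝ) : Prop where
  energy : ∀ k < N, Integrable (fun z => ‖z.2‖ ^ 2) (stageLaw A B ν π k)
  entropy_ae : ∀ k < N, ∀ᵐ x ∂(stateLaw A B ν π k),
    Integrable (fun u => π k x u * Real.log (π k x u)) volume
  entropy_int : ∀ k < N, Integrable (fun x => entropy (π k x)) (stateLaw A B ν π k)

open Classical in
/-- The cost `E[∑_{k<N} (‖u_k‖²/2 - ε H(π_k(·|x_k)))]`, with values in `(-∞, +∞]`.
Conditionally on `x_k = x`, the stage cost `E[‖u_k‖² | x_k = x]/2 - ε H(π_k(·|x))` is `ε` times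
the relative entropy of `π_k(·|x)` with respect to `N(0, ε I)` plus a constant; in particular it
is bounded below, and a policy for which one of the integrals is not finite has cost `+∞`. -/
def cost (A : ℕ → Matrix (Fin n) (Fin n) ℝ) (B : ℕ → Matrix (Fin n) (Fin m) ℝ)
    (N : ℕ) (ε : ℝ) (ν : Measure (EuclideanSpace ℝ (Fin n)))
    (π : ℕ → EuclideanSpace ℝ (Fin n) → EuclideanSpace ℝ (Fin m) → ℝ) : EReal :=
  if HasFiniteCost A B N ν π then
    ((∑ k ∈ Finset.range N,
      ∫ z, (1 / 2 * ‖z.2‖ ^ 2 - ε * entropy (π k z.1)) ∂(stageLaw A B ν π k) : ℝ) : EReal)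
  else ⊤

/-- Policies that steer `x_0 ∼ N(0, Σ₀)` to `x_N ∼ N(0, Σ_N)`. -/
structure IsFeasible (A : ℕ → Matrix (Fin n) (Fin n) ℝ) (B : ℕ → Matrix (Fin n) (Fin m) ℝ)
    (N : ℕ) (Sig₀ SigN : Matrix (Fin n) (Fin n) ℝ)
    (π : ℕ → EuclideanSpace ℝ (Fin n) → EuclideanSpace ℝ (Fin m) → ℝ) : Prop where
  policy : IsPolicy N π
  final : stateLaw A B (multivariateGaussian 0 Sig₀) π N = multivariateGaussian 0 SigN

/-- Optimal policies of the maximum entropy optimal density control problem. -/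
structure IsOptimal (A : ℕ → Matrix (Fin n) (Fin n) ℝ) (B : ℕ → Matrix (Fin n) (Fin m) ℝ)
    (N : ℕ) (ε : ℝ) (Sig₀ SigN : Matrix (Fin n) (Fin n) ℝ)
    (π : ℕ → EuclideanSpace ℝ (Fin n) → EuclideanSpace ℝ (Fin m) → ℝ) : Prop where
  feasible : IsFeasible A B N Sig₀ SigN π
  minimal : ∀ ρ, IsFeasible A B N Sig₀ SigN ρ →
    cost A B N ε (multivariateGaussian 0 Sig₀) π ≤ cost A B N ε (multivariateGaussian 0 Sig₀) ρ

/-- `I + B_kᵀ Q_{-,k+1}⁻¹ B_k`. -/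
def gainMatrix (A : ℕ → Matrix (Fin n) (Fin n) ℝ) (B : ℕ → Matrix (Fin n) (Fin m) ℝ)
    (N : ℕ) (ε : ℝ) (Sig₀ SigN : Matrix (Fin n) (Fin n) ℝ) (k : ℕ) :
    Matrix (Fin m) (Fin m) ℝ :=
  1 + (B k)ᵀ * (Qminus A B N ε Sig₀ SigN (k + 1))⁻¹ * B k

/-- The Gaussian policy with mean `-(I + Bᵀ Q⁻¹ B)⁻¹ Bᵀ Q⁻¹ A x` and covariance
`ε (I + Bᵀ Q⁻¹ B)⁻¹`, where `A = A_k`, `B = B_k` and `Q = Q_{-,k+1}`. -/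
def optPolicy (A : ℕ → Matrix (Fin n) (Fin n) ℝ) (B : ℕ → Matrix (Fin n) (Fin m) ℝ)
    (N : ℕ) (ε : ℝ) (Sig₀ SigN : Matrix (Fin n) (Fin n) ℝ) (k : ℕ)
    (x : EuclideanSpace ℝ (Fin n)) : EuclideanSpace ℝ (Fin m) → ℝ :=
  gaussianDensity
    (-Matrix.toEuclideanLin ((gainMatrix A B N ε Sig₀ SigN k)⁻¹ * (B k)ᵀ *
      (Qminus A B N ε Sig₀ SigN (k + 1))⁻¹ * A k) x)
    (ε • (gainMatrix A B N ε Sig₀ SigN k)⁻¹)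

end Control

end DensityControl

end

/-! The proof is a verification argument. With `V_k(x) = ½ xᵀ Q_{-,k}⁻¹ x`, the recursion for
`Q_{-,k}` is a Riccati equation for its inverse (`riccati`). Completing the square
(`complete_square`) gives `½‖u‖² = V_k(x) - V_{k+1}(x') +` a quadratic in `u`, where `x'` is the
next state. That quadratic is `-ε log π*_k(u|x)` up to a constant. Taking expectations, each stage
cost is a difference of mean values, a constant, and `ε` times the expected relative entropy of
`π_k` with respect to `π*_k` (`stage_identity`). The sum telescopes, and feasibility fixes both end
laws. The finite cost of a feasible policy is therefore a constant plus `ε` times a sum of relative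
entropies (`total_cost_eq`), and Gibbs' inequality with its equality case gives optimality and
uniqueness.

It remains to see that everything is well defined and that `π*` is feasible. Write `G = G_c(N,0)`,
`L = G^{1/2} S₀^{1/2}`, so that `L Lᵀ = ε⁻¹ Σ₀`, and `D = (S₀^{1/2} S_N S₀^{1/2} + I/4)^{1/2} -
I/2`, which is positive definite. Then `q₀ = Q_{-,0}` satisfies `q₀⁻¹ = G⁻¹ - T` with `T = L⁻ᵀ D L⁻¹
> 0`. Pulled back to time 0, `Q_{-,k}` is `q₀ - G_c(k,0)`. Since `0 ≤ G_c(k,0) ≤ G`, it is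
invertible (`isUnit_sub_of_le`). The same argument applied to a segment between two consecutive
Gramians makes `I + Bᵀ Q⁻¹ B` positive definite (`posDef_one_add_of_isUnit`).

For feasibility, the closed loop carries the Gaussian covariance `ε (Q - Q W Q)` to one of the same
form, with `W` merely transported by `A⁻¹` (`closedLoop_covariance`). The initial condition
determines `W`. The terminal condition then reduces to `D² + D = S₀^{1/2} S_N S₀^{1/2}`, which is
the definition of `D` (`boundary_final`). -/

namespace DensityControl

/-! ### Positivity and invertibility of matrices. -/

section MatrixLemmas

variable {n m : ℕ}

lemma dotProduct_transpose_mulVec {p q : ℕ} (M : Matrix (Fin p) (Fin q) ℝ) (x : Fin q → ℝ)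
    (y : Fin p → ℝ) : x ⬝ᵥ Mᵀ *ᵥ y = (M *ᵥ x) ⬝ᵥ y := by
  rw [mulVec_transpose, dotProduct_comm, ← dotProduct_mulVec, dotProduct_comm]

lemma dotProduct_mulVec_symm {M : Matrix (Fin n) (Fin n) ℝ} (hM : Mᵀ = M) (x y : Fin n → ℝ) :
    x ⬝ᵥ M *ᵥ y = y ⬝ᵥ M *ᵥ x := by
  conv_lhs => rw [← hM]
  rw [dotProduct_transpose_mulVec, dotProduct_comm]

lemma transpose_eq_of_posSemidef {M : Matrix (Fin n) (Fin n) ℝ} (hM : M.PosSemidef) :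
    Mᵀ = M := by
  rw [← conjTranspose_eq_transpose_of_trivial]
  exact hM.1

lemma transpose_eq_of_posDef {M : Matrix (Fin n) (Fin n) ℝ} (hM : M.PosDef) : Mᵀ = M :=
  transpose_eq_of_posSemidef hM.posSemidef

lemma dotProduct_mulVec_nonneg {M : Matrix (Fin n) (Fin n) ℝ} (hM : M.PosSemidef)
    (x : Fin n → ℝ) : 0 ≤ x ⬝ᵥ M *ᵥ x := by
  simpa using hM.dotProduct_mulVec_nonneg x

lemma eq_zero_of_dotProduct_mulVec_nonpos {M : Matrix (Fin n) (Fin n) ℝ} (hM : M.PosDef)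
    {x : Fin n → ℝ} (hx : x ⬝ᵥ M *ᵥ x ≤ 0) : x = 0 := by
  by_contra h
  have := hM.dotProduct_mulVec_pos h
  simp only [star_trivial] at this
  linarith

lemma mul_mul_transpose_posSemidef {p q : ℕ} {M : Matrix (Fin p) (Fin p) ℝ} (hM : M.PosSemidef)
    (C : Matrix (Fin q) (Fin p) ℝ) : (C * M * Cᵀ).PosSemidef := by
  simpa using hM.mul_mul_conjTranspose_same C

lemma mul_transpose_posSemidef {p q : ℕ} (C : Matrix (Fin q) (Fin p) ℝ) :
    (C * Cᵀ).PosSemidef := by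
  simpa using mul_mul_transpose_posSemidef PosSemidef.one C

lemma mul_mul_transpose_posDef {M C : Matrix (Fin n) (Fin n) ℝ} (hM : M.PosDef)
    (hC : IsUnit C) : (C * M * Cᵀ).PosDef := by
  refine (mul_mul_transpose_posSemidef hM.posSemidef C).posDef_iff_isUnit.2 ?_
  exact (hC.mul hM.isUnit).mul ((isUnit_transpose C).2 hC)

/-- A symmetric matrix all of whose eigenvalues are positive is positive definite. -/
lemma posDef_of_eigenvalues_pos {H : Matrix (Fin n) (Fin n) ℝ} (hH : Hᵀ = H)
    (h : ∀ (c : ℝ) (v : Fin n → ℝ), v ≠ 0 → H *ᵥ v = c • v → 0 < c) : H.PosDef := by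
  have hH' : H.IsHermitian := by
    rw [IsHermitian, conjTranspose_eq_transpose_of_trivial, hH]
  rw [hH'.posDef_iff_eigenvalues_pos]
  intro i
  refine h _ _ ?_ (hH'.mulVec_eigenvectorBasis i)
  intro h0
  have := hH'.eigenvectorBasis.orthonormal.ne_zero i
  exact this (by ext j; exact congrFun h0 j)

lemma isUnit_of_mulVec_eq_zero {M : Matrix (Fin n) (Fin n) ℝ}
    (h : ∀ v, M *ᵥ v = 0 → v = 0) : IsUnit M := by
  rw [isUnit_iff_isUnit_det, isUnit_iff_ne_zero]
  intro hd
  obtain ⟨v, hv, hv0⟩ := exists_mulVec_eq_zero_iff.2 hd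
  exact hv (h v hv0)

lemma eq_zero_of_isUnit_mulVec {M : Matrix (Fin n) (Fin n) ℝ} (hM : IsUnit M) {v : Fin n → ℝ}
    (h : M *ᵥ v = 0) : v = 0 :=
  mulVec_injective_iff_isUnit.2 hM (by rw [h, mulVec_zero])

lemma mul_inv_of_isUnit {M : Matrix (Fin n) (Fin n) ℝ} (hM : IsUnit M) : M * M⁻¹ = 1 :=
  mul_nonsing_inv _ ((isUnit_iff_isUnit_det _).1 hM)

lemma inv_mul_of_isUnit {M : Matrix (Fin n) (Fin n) ℝ} (hM : IsUnit M) : M⁻¹ * M = 1 :=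
  nonsing_inv_mul _ ((isUnit_iff_isUnit_det _).1 hM)

/-- If `q₀⁻¹ = G⁻¹ - T` with `G`, `T` positive definite and `0 ≤ g ≤ G`, then `q₀ - g` is
invertible. -/
lemma isUnit_sub_of_le {G T q₀ g : Matrix (Fin n) (Fin n) ℝ} (hG : G.PosDef) (hT : T.PosDef)
    (hq : (G⁻¹ - T) * q₀ = 1) (hg : g.PosSemidef) (hgG : (G - g).PosSemidef) :
    IsUnit (q₀ - g) := by
  refine isUnit_of_mulVec_eq_zero fun v hv => ?_
  have h1 : v = G⁻¹ *ᵥ (g *ᵥ v) - T *ᵥ (g *ᵥ v) := by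
    have hv' : q₀ *ᵥ v = g *ᵥ v := by
      rw [sub_mulVec] at hv
      exact sub_eq_zero.1 hv
    rw [← sub_mulVec, ← hv', mulVec_mulVec, hq, one_mulVec]
  set y := G⁻¹ *ᵥ (g *ᵥ v) with hy
  have hGy : G *ᵥ y = g *ᵥ v := by
    rw [hy, mulVec_mulVec, mul_inv_of_isUnit hG.isUnit, one_mulVec]
  -- For invertible `g` this is `q₀⁻¹ < G⁻¹ ≤ g⁻¹`. As `g` may be singular, the comparison is made
  -- on `g v`: adding the two inequalities gives `v·gv ≥ y·gv`, while `v = y - T g v` gives `v·gv =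
  -- y·gv - gv·T gv`. Hence `gv·T gv ≤ 0`.
  have h2 := dotProduct_mulVec_nonneg hg (y - v)
  have h3 := dotProduct_mulVec_nonneg hgG y
  have hgs := dotProduct_mulVec_symm (transpose_eq_of_posSemidef hg) v y
  simp only [mulVec_sub, sub_mulVec, dotProduct_sub, sub_dotProduct, hGy] at h2 h3
  have h5 : (g *ᵥ v) ⬝ᵥ v = (g *ᵥ v) ⬝ᵥ y - (g *ᵥ v) ⬝ᵥ T *ᵥ (g *ᵥ v) := by
    rw [← dotProduct_sub, ← h1]
  rw [dotProduct_comm _ v, dotProduct_comm _ y] at h5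
  have h6 : g *ᵥ v = 0 := eq_zero_of_dotProduct_mulVec_nonpos hT (by linarith)
  rw [h1, hy, h6, mulVec_zero, mulVec_zero, sub_zero]

/-- If `Q + t B Bᵀ` is invertible for all `t ∈ [0, 1]`, then `I + Bᵀ Q⁻¹ B` is positive
definite. -/
lemma posDef_one_add_of_isUnit {Q : Matrix (Fin n) (Fin n) ℝ} (B : Matrix (Fin n) (Fin m) ℝ)
    (hQ : Qᵀ = Q) (h : ∀ t : ℝ, 0 ≤ t → t ≤ 1 → IsUnit (Q + t • (B * Bᵀ))) :
    (1 + Bᵀ * Q⁻¹ * B).PosDef := by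
  have hu : IsUnit Q := by simpa using h 0 le_rfl zero_le_one
  refine posDef_of_eigenvalues_pos ?_ fun c v hv hc => ?_
  · simp [transpose_mul, transpose_nonsing_inv, hQ, Matrix.mul_assoc]
  by_contra hneg
  push Not at hneg
  have hlam : (Bᵀ * Q⁻¹ * B) *ᵥ v = (c - 1) • v := by
    rw [add_mulVec, one_mulVec] at hc
    rw [sub_smul, ← hc, one_smul]; simp
  set y := (Q⁻¹ * B) *ᵥ v with hy
  have hQy : Q *ᵥ y = B *ᵥ v := by
    rw [hy, mulVec_mulVec, ← Matrix.mul_assoc, mul_inv_of_isUnit hu, Matrix.one_mul]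
  have hBy : Bᵀ *ᵥ y = (c - 1) • v := by
    rw [hy, mulVec_mulVec, ← Matrix.mul_assoc, hlam]
  have hc1 : 0 < 1 - c := by linarith
  have h0 : y = 0 := by
    -- From `Q y = B v` and `Bᵀ y = (c - 1) v`, one gets `(Q + t B Bᵀ) y = (1 + t (c - 1)) B v`. It
    -- vanishes at `t = (1 - c)⁻¹`, which lies in `(0, 1]` exactly because `c ≤ 0`.
    refine eq_zero_of_isUnit_mulVec (h (1 - c)⁻¹ (by positivity) ?_) ?_
    · exact inv_le_one_of_one_le₀ (by linarith)
    · rw [add_mulVec, smul_mulVec, ← mulVec_mulVec, hBy, hQy, mulVec_smul, smul_smul]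
      have : (1 - c)⁻¹ * (c - 1) = -1 := by field_simp; ring
      rw [this]; simp
  rw [h0, mulVec_zero] at hBy
  have : v = 0 := (smul_eq_zero.1 hBy.symm).resolve_left (by linarith)
  exact hv this

/-- If `R ≥ 0` and `R² = C + I/4` with `C` positive definite, then `R - I/2` is positive
definite. -/
lemma posDef_sub_half {R C : Matrix (Fin n) (Fin n) ℝ} (hR : R.PosSemidef) (hC : C.PosDef)
    (h : R * R = C + (1 / 4 : ℝ) • 1) : (R - (1 / 2 : ℝ) • 1).PosDef := by
  refine posDef_of_eigenvalues_pos ?_ fun c v hv hc => ?_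
  · simp [transpose_eq_of_posSemidef hR]
  have hRv : R *ᵥ v = (c + 1 / 2) • v := by
    rw [sub_mulVec, smul_mulVec, one_mulVec] at hc
    rw [add_smul, ← hc]; simp
  have hvv : 0 < v ⬝ᵥ v := by
    have := (PosDef.one (n := Fin n) (R := ℝ)).dotProduct_mulVec_pos hv
    simpa using this
  have h1 := dotProduct_mulVec_nonneg hR v
  have h2 := hC.dotProduct_mulVec_pos hv
  -- Eigenvectors of `R` are eigenvectors of `C`. So `(c + 1/2)² > 1/4`, and `R ≥ 0` selects the
  -- branch `c + 1/2 > 1/2`.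
  have h3 : C *ᵥ v = ((c + 1 / 2) ^ 2 - 1 / 4) • v := by
    have : C = R * R - (1 / 4 : ℝ) • 1 := by rw [h]; simp
    rw [this, sub_mulVec, ← mulVec_mulVec, hRv, mulVec_smul, hRv, smul_mulVec, one_mulVec,
      smul_smul, ← sub_smul]
    ring_nf
  rw [hRv, dotProduct_smul, smul_eq_mul] at h1
  rw [h3, star_trivial, dotProduct_smul, smul_eq_mul] at h2
  have h4 : 0 ≤ c + 1 / 2 := nonneg_of_mul_nonneg_left h1 hvv
  have h5 : 0 < (c + 1 / 2) ^ 2 - 1 / 4 := pos_of_mul_pos_left h2 hvv.le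
  nlinarith

/-! ### One step of the recursion: closed loop, covariance, Riccati equation. -/

section Step

variable {A Q Q' : Matrix (Fin n) (Fin n) ℝ} {B : Matrix (Fin n) (Fin m) ℝ}

/-- The closed-loop matrix `A - B K` of the gain `K = (I + Bᵀ Q'⁻¹ B)⁻¹ Bᵀ Q'⁻¹ A`. -/
lemma closedLoop_mul (hQ' : IsUnit Q') (hΓ : IsUnit (1 + Bᵀ * Q'⁻¹ * B))
    (hstep : Q' = A * Q * Aᵀ - B * Bᵀ) :
    (A - B * ((1 + Bᵀ * Q'⁻¹ * B)⁻¹ * Bᵀ * Q'⁻¹ * A)) * (Q * Aᵀ) = Q' := by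
  set Γ := 1 + Bᵀ * Q'⁻¹ * B with hΓdef
  have h1 : A * Q * Aᵀ = Q' + B * Bᵀ := by rw [hstep]; abel
  -- Push-through identity: it cancels the `Γ⁻¹` of the gain and leaves `Q' + B Bᵀ - B Bᵀ`.
  have h2 : Bᵀ * Q'⁻¹ * (Q' + B * Bᵀ) = Γ * Bᵀ := by
    rw [hΓdef, Matrix.mul_add, Matrix.mul_assoc Bᵀ, inv_mul_of_isUnit hQ', Matrix.add_mul]
    simp [Matrix.mul_assoc]
  calc (A - B * (Γ⁻¹ * Bᵀ * Q'⁻¹ * A)) * (Q * Aᵀ)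
      = A * Q * Aᵀ - B * Γ⁻¹ * (Bᵀ * Q'⁻¹ * (A * Q * Aᵀ)) := by
        simp only [Matrix.sub_mul, Matrix.mul_assoc]
    _ = Q' + B * Bᵀ - B * (Γ⁻¹ * Γ) * Bᵀ := by rw [h1, h2]; simp only [Matrix.mul_assoc]
    _ = Q' := by rw [inv_mul_of_isUnit hΓ, Matrix.mul_one]; abel

/-- Since `a Q Aᵀ = Q'` for the closed-loop matrix `a`, the determinant of `a` divides that of `Q'`.
This keeps the state covariance nondegenerate even when `B Bᵀ` is singular. -/
lemma closedLoop_isUnit (hA : IsUnit A) (hQ : IsUnit Q) (hQ' : IsUnit Q')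
    (hΓ : IsUnit (1 + Bᵀ * Q'⁻¹ * B)) (hstep : Q' = A * Q * Aᵀ - B * Bᵀ) :
    IsUnit (A - B * ((1 + Bᵀ * Q'⁻¹ * B)⁻¹ * Bᵀ * Q'⁻¹ * A)) := by
  have h := closedLoop_mul hQ' hΓ hstep
  have hu : IsUnit (Q * Aᵀ) := hQ.mul ((isUnit_transpose A).2 hA)
  rw [isUnit_iff_isUnit_det] at hQ' ⊢
  rw [← h, det_mul] at hQ'
  exact isUnit_of_mul_isUnit_left hQ'

/-- Covariance propagation of the closed loop. -/
lemma closedLoop_covariance (W : Matrix (Fin n) (Fin n) ℝ) (hA : IsUnit A)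
    (hQ' : IsUnit Q') (hQs : Qᵀ = Q) (hQs' : Q'ᵀ = Q')
    (hΓ : IsUnit (1 + Bᵀ * Q'⁻¹ * B)) (hstep : Q' = A * Q * Aᵀ - B * Bᵀ) :
    (A - B * ((1 + Bᵀ * Q'⁻¹ * B)⁻¹ * Bᵀ * Q'⁻¹ * A)) * (Q - Q * W * Q) *
        (A - B * ((1 + Bᵀ * Q'⁻¹ * B)⁻¹ * Bᵀ * Q'⁻¹ * A))ᵀ +
      B * (1 + Bᵀ * Q'⁻¹ * B)⁻¹ * Bᵀ =
    Q' - Q' * ((A⁻¹)ᵀ * W * A⁻¹) * Q' := by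
  have h1 := closedLoop_mul hQ' hΓ hstep
  have hΓs : (1 + Bᵀ * Q'⁻¹ * B)ᵀ = 1 + Bᵀ * Q'⁻¹ * B := by
    simp [transpose_mul, transpose_nonsing_inv, hQs', Matrix.mul_assoc]
  set Γ := 1 + Bᵀ * Q'⁻¹ * B with hΓdef
  set a := A - B * (Γ⁻¹ * Bᵀ * Q'⁻¹ * A) with ha
  have hAt : Aᵀ * (A⁻¹)ᵀ = 1 := by
    rw [← transpose_mul, inv_mul_of_isUnit hA, transpose_one]
  have h2 : a * Q = Q' * (A⁻¹)ᵀ := by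
    rw [← h1, Matrix.mul_assoc, Matrix.mul_assoc, hAt, Matrix.mul_one]
  have h3 : Q * aᵀ = A⁻¹ * Q' := by
    have := congrArg transpose h2
    simpa [transpose_mul, hQs, hQs'] using this
  have h4 : aᵀ = Aᵀ - Aᵀ * Q'⁻¹ * B * Γ⁻¹ * Bᵀ := by
    simp [ha, transpose_sub, transpose_mul, transpose_nonsing_inv, hQs', hΓs, Matrix.mul_assoc]
  -- This is the case `W = 0`. The `W` term is then transported by `a Q = Q' (A⁻¹)ᵀ` and its
  -- transpose.
  have h5 : a * Q * aᵀ = Q' - B * Γ⁻¹ * Bᵀ := by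
    calc a * Q * aᵀ = a * (Q * Aᵀ) - a * (Q * Aᵀ) * Q'⁻¹ * (B * Γ⁻¹ * Bᵀ) := by
          rw [h4]; simp only [Matrix.mul_sub, Matrix.mul_assoc]
      _ = _ := by rw [h1, mul_inv_of_isUnit hQ', Matrix.one_mul]
  calc a * (Q - Q * W * Q) * aᵀ + B * Γ⁻¹ * Bᵀ
      = a * Q * aᵀ - (a * Q) * W * (Q * aᵀ) + B * Γ⁻¹ * Bᵀ := by
        simp only [Matrix.mul_sub, Matrix.sub_mul, Matrix.mul_assoc]
    _ = _ := by
        rw [h5, h2, h3]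
        simp only [Matrix.mul_assoc]
        abel

/-- The Riccati equation of the inverse matrices. -/
lemma riccati (hA : IsUnit A) (hQ' : IsUnit Q')
    (hΓ : IsUnit (1 + Bᵀ * Q'⁻¹ * B)) (hstep : Q' = A * Q * Aᵀ - B * Bᵀ) :
    Aᵀ * Q'⁻¹ * (A - B * ((1 + Bᵀ * Q'⁻¹ * B)⁻¹ * Bᵀ * Q'⁻¹ * A)) = Q⁻¹ := by
  have h1 := closedLoop_mul hQ' hΓ hstep
  set a := A - B * ((1 + Bᵀ * Q'⁻¹ * B)⁻¹ * Bᵀ * Q'⁻¹ * A) with ha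
  have hAt : Aᵀ * (A⁻¹)ᵀ = 1 := by
    rw [← transpose_mul, inv_mul_of_isUnit hA, transpose_one]
  have h2 : Aᵀ * Q'⁻¹ * a * Q = 1 := by
    calc Aᵀ * Q'⁻¹ * a * Q = Aᵀ * Q'⁻¹ * (a * (Q * Aᵀ)) * (A⁻¹)ᵀ := by
          simp only [Matrix.mul_assoc, hAt, Matrix.mul_one]
      _ = 1 := by
          rw [h1, Matrix.mul_assoc Aᵀ, inv_mul_of_isUnit hQ', Matrix.mul_one, hAt]
  exact (inv_eq_left_inv h2).symm

/-- Completion of squares. -/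
lemma complete_square (hA : IsUnit A) (hQ' : IsUnit Q') (hQs' : Q'ᵀ = Q')
    (hΓ : IsUnit (1 + Bᵀ * Q'⁻¹ * B)) (hstep : Q' = A * Q * Aᵀ - B * Bᵀ)
    (x : Fin n → ℝ) (u : Fin m → ℝ) :
    u ⬝ᵥ u + (A *ᵥ x + B *ᵥ u) ⬝ᵥ Q'⁻¹ *ᵥ (A *ᵥ x + B *ᵥ u) =
      (u + ((1 + Bᵀ * Q'⁻¹ * B)⁻¹ * Bᵀ * Q'⁻¹ * A) *ᵥ x) ⬝ᵥ (1 + Bᵀ * Q'⁻¹ * B) *ᵥ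
        (u + ((1 + Bᵀ * Q'⁻¹ * B)⁻¹ * Bᵀ * Q'⁻¹ * A) *ᵥ x) + x ⬝ᵥ Q⁻¹ *ᵥ x := by
  rw [← riccati hA hQ' hΓ hstep]
  have hΓs : (1 + Bᵀ * Q'⁻¹ * B)ᵀ = 1 + Bᵀ * Q'⁻¹ * B := by
    simp [transpose_mul, transpose_nonsing_inv, hQs', Matrix.mul_assoc]
  have hPs : (Q'⁻¹)ᵀ = Q'⁻¹ := by rw [transpose_nonsing_inv, hQs']
  set P := Q'⁻¹
  have hgam : ∀ z, (1 + Bᵀ * P * B) *ᵥ z = z + Bᵀ *ᵥ P *ᵥ B *ᵥ z := by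
    intro z; simp [add_mulVec, Matrix.mul_assoc]
  set Γ := 1 + Bᵀ * P * B with hΓdef
  set k := (Γ⁻¹ * Bᵀ * P * A) *ᵥ x with hk
  -- The gain is chosen so that `Γ k` is the coefficient of the cross term in `u`. The remaining
  -- square `kᵀ Γ k` is what the Riccati equation subtracts from `(A x)ᵀ P (A x)`.
  have hΓk : Γ *ᵥ k = Bᵀ *ᵥ P *ᵥ A *ᵥ x := by
    rw [hk, mulVec_mulVec, ← Matrix.mul_assoc, ← Matrix.mul_assoc, ← Matrix.mul_assoc,
      mul_inv_of_isUnit hΓ]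
    simp [Matrix.mul_assoc]
  have h1 : k ⬝ᵥ Γ *ᵥ u = u ⬝ᵥ Γ *ᵥ k := dotProduct_mulVec_symm hΓs _ _
  have h2 : x ⬝ᵥ (Aᵀ * P * (A - B * (Γ⁻¹ * Bᵀ * P * A))) *ᵥ x =
      (A *ᵥ x) ⬝ᵥ P *ᵥ (A *ᵥ x) - (B *ᵥ k) ⬝ᵥ P *ᵥ (A *ᵥ x) := by
    rw [← mulVec_mulVec, ← mulVec_mulVec, dotProduct_transpose_mulVec, sub_mulVec,
      ← mulVec_mulVec, ← hk, mulVec_sub, dotProduct_sub,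
      dotProduct_mulVec_symm hPs (A *ᵥ x) (B *ᵥ k)]
  have h3 : k ⬝ᵥ Γ *ᵥ k = (B *ᵥ k) ⬝ᵥ P *ᵥ (A *ᵥ x) := by
    rw [hΓk, dotProduct_transpose_mulVec]
  have h4 : u ⬝ᵥ Γ *ᵥ k = (B *ᵥ u) ⬝ᵥ P *ᵥ (A *ᵥ x) := by
    rw [hΓk, dotProduct_transpose_mulVec]
  have h5 : u ⬝ᵥ Γ *ᵥ u = u ⬝ᵥ u + (B *ᵥ u) ⬝ᵥ P *ᵥ (B *ᵥ u) := by
    rw [hgam, dotProduct_add, dotProduct_transpose_mulVec]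
  have h6 := dotProduct_mulVec_symm hPs (A *ᵥ x) (B *ᵥ u)
  rw [h2]
  simp only [mulVec_add, dotProduct_add, add_dotProduct]
  rw [h1, h3, h4, h5, h6]
  ring

end Step

/-! ### The boundary conditions for the covariance, at time 0 coordinates. -/

section Boundary

variable {L G D s₁ : Matrix (Fin n) (Fin n) ℝ}

/-- Congruence by `L⁻¹` turns `F = Lᵀ G⁻¹ L - D` into `G⁻¹ - T`, so `q₀ = L F⁻¹ Lᵀ` has inverse `G⁻¹
- T`. -/
lemma inv_boundary_mul (hL : IsUnit L) (hF : IsUnit (Lᵀ * G⁻¹ * L - D)) :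
    (G⁻¹ - (L⁻¹)ᵀ * D * L⁻¹) * (L * (Lᵀ * G⁻¹ * L - D)⁻¹ * Lᵀ) = 1 := by
  set F := Lᵀ * G⁻¹ * L - D with hFdef
  have hLt : (L⁻¹)ᵀ * Lᵀ = 1 := by
    rw [← transpose_mul, mul_inv_of_isUnit hL, transpose_one]
  have h1 : G⁻¹ - (L⁻¹)ᵀ * D * L⁻¹ = (L⁻¹)ᵀ * F * L⁻¹ := by
    rw [hFdef, Matrix.mul_sub, Matrix.sub_mul]
    congr 1
    calc G⁻¹ = ((L⁻¹)ᵀ * Lᵀ) * G⁻¹ * (L * L⁻¹) := by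
          rw [hLt, mul_inv_of_isUnit hL, Matrix.one_mul, Matrix.mul_one]
      _ = _ := by simp only [Matrix.mul_assoc]
  rw [h1]
  calc (L⁻¹)ᵀ * F * L⁻¹ * (L * F⁻¹ * Lᵀ) = (L⁻¹)ᵀ * (F * ((L⁻¹ * L) * F⁻¹)) * Lᵀ := by
        simp only [Matrix.mul_assoc]
    _ = 1 := by
        rw [inv_mul_of_isUnit hL, Matrix.one_mul, mul_inv_of_isUnit hF, Matrix.mul_one, hLt]

/-- With `q₀⁻¹ = G⁻¹ - T`, both `q₀ - G = G T q₀` and `q₀ - G = q₀ T G` hold. Substituting them, the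
terms in `q₀` cancel and the left side becomes `G (T + T L Lᵀ T) G`. The bracket is `L⁻ᵀ (D + D²)
L⁻¹`, so the quadratic equation for `D` is exactly the terminal condition. -/
lemma boundary_final (hL : IsUnit L) (hG : IsUnit G)
    (hF : IsUnit (Lᵀ * G⁻¹ * L - D)) (hD : D * D + D = Lᵀ * G⁻¹ * s₁ * G⁻¹ * L)
    {q₀ : Matrix (Fin n) (Fin n) ℝ} (hq₀ : q₀ = L * (Lᵀ * G⁻¹ * L - D)⁻¹ * Lᵀ) :
    (q₀ - G) - (q₀ - G) * (q₀⁻¹ - q₀⁻¹ * (L * Lᵀ) * q₀⁻¹) * (q₀ - G) = s₁ := by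
  have hLt : (L⁻¹)ᵀ * Lᵀ = 1 := by
    rw [← transpose_mul, mul_inv_of_isUnit hL, transpose_one]
  have hLt' : Lᵀ * (L⁻¹)ᵀ = 1 := by
    rw [← transpose_mul, inv_mul_of_isUnit hL, transpose_one]
  have h1 : (G⁻¹ - (L⁻¹)ᵀ * D * L⁻¹) * q₀ = 1 := by rw [hq₀]; exact inv_boundary_mul hL hF
  set T := (L⁻¹)ᵀ * D * L⁻¹ with hT
  have h1' : q₀ * (G⁻¹ - T) = 1 := mul_eq_one_comm.1 h1
  have hinv : q₀⁻¹ = G⁻¹ - T := inv_eq_left_inv h1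
  have hGG := mul_inv_of_isUnit hG
  have hGG' := inv_mul_of_isUnit hG
  have h2 : q₀ - G = G * T * q₀ := by
    have : G * ((G⁻¹ - T) * q₀) = G := by rw [h1, Matrix.mul_one]
    rw [Matrix.sub_mul, Matrix.mul_sub, ← Matrix.mul_assoc, hGG, Matrix.one_mul,
      ← Matrix.mul_assoc] at this
    rw [sub_eq_iff_eq_add, add_comm, ← sub_eq_iff_eq_add]
    exact this
  have h3 : q₀ - G = q₀ * T * G := by
    have : q₀ * (G⁻¹ - T) * G = G := by rw [h1', Matrix.one_mul]
    rw [Matrix.mul_sub, Matrix.sub_mul, Matrix.mul_assoc, hGG', Matrix.mul_one] at this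
    rw [sub_eq_iff_eq_add, add_comm, ← sub_eq_iff_eq_add]
    exact this
  have hw : q₀ * (q₀⁻¹ - q₀⁻¹ * (L * Lᵀ) * q₀⁻¹) * q₀ = q₀ - L * Lᵀ := by
    rw [hinv, Matrix.mul_sub, Matrix.sub_mul, h1', Matrix.one_mul]
    congr 1
    rw [← Matrix.mul_assoc, ← Matrix.mul_assoc, h1', Matrix.one_mul, Matrix.mul_assoc, h1,
      Matrix.mul_one]
  set w := q₀⁻¹ - q₀⁻¹ * (L * Lᵀ) * q₀⁻¹
  have h4 : (q₀ - G) * w * (q₀ - G) = G * T * (q₀ - L * Lᵀ) * T * G := by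
    calc (q₀ - G) * w * (q₀ - G) = (G * T * q₀) * w * (q₀ * T * G) := by rw [← h2, ← h3]
      _ = G * T * (q₀ * w * q₀) * T * G := by simp only [Matrix.mul_assoc]
      _ = _ := by rw [hw]
  have h5 : q₀ - G = G * T * q₀ * T * G + G * T * G := by
    calc q₀ - G = G * T * q₀ := h2
      _ = G * T * (q₀ * T * G + G) := by rw [← h3]; congr 1; abel
      _ = _ := by simp only [Matrix.mul_add, Matrix.mul_assoc]
  have h6 : T * (L * Lᵀ) * T = (L⁻¹)ᵀ * (D * D) * L⁻¹ := by
    calc T * (L * Lᵀ) * T = (L⁻¹)ᵀ * D * ((L⁻¹ * L) * (Lᵀ * (L⁻¹)ᵀ)) * D * L⁻¹ := by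
          rw [hT]; simp only [Matrix.mul_assoc]
      _ = _ := by
        rw [inv_mul_of_isUnit hL, hLt']; simp only [Matrix.mul_assoc, Matrix.mul_one]
  have h7 : T + T * (L * Lᵀ) * T = G⁻¹ * s₁ * G⁻¹ := by
    calc T + T * (L * Lᵀ) * T = (L⁻¹)ᵀ * (D * D + D) * L⁻¹ := by
          rw [h6, hT, Matrix.mul_add, Matrix.add_mul, add_comm]
      _ = ((L⁻¹)ᵀ * Lᵀ) * (G⁻¹ * s₁ * G⁻¹) * (L * L⁻¹) := by
          rw [hD]; simp only [Matrix.mul_assoc]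
      _ = _ := by rw [hLt, mul_inv_of_isUnit hL, Matrix.one_mul, Matrix.mul_one]
  rw [h4]
  calc q₀ - G - G * T * (q₀ - L * Lᵀ) * T * G
      = G * T * q₀ * T * G + G * T * G - G * T * (q₀ - L * Lᵀ) * T * G := by rw [← h5]
    _ = G * (T + T * (L * Lᵀ) * T) * G := by
        simp only [Matrix.mul_add, Matrix.add_mul, Matrix.mul_sub, Matrix.sub_mul,
          Matrix.mul_assoc]
        abel
    _ = (G * G⁻¹) * s₁ * (G⁻¹ * G) := by rw [h7]; simp only [Matrix.mul_assoc]
    _ = s₁ := by rw [hGG, hGG', Matrix.one_mul, Matrix.mul_one]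

end Boundary

end MatrixLemmas

/-! ### Transition matrices and Gramians. -/

section System

variable {n m : ℕ} {A : ℕ → Matrix (Fin n) (Fin n) ℝ} {B : ℕ → Matrix (Fin n) (Fin m) ℝ}
  {N : ℕ} {ε : ℝ} {Sig₀ SigN : Matrix (Fin n) (Fin n) ℝ}

lemma transFwd_zero_succ (A : ℕ → Matrix (Fin n) (Fin n) ℝ) (k : ℕ) :
    transFwd A 0 (k + 1) = A k * transFwd A 0 k := by
  simp [transFwd]

lemma isUnit_transFwd (hA : ∀ k < N, IsUnit (A k)) : ∀ k ≤ N, IsUnit (transFwd A 0 k)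
  | 0, _ => by simp [transFwd]
  | k + 1, hk => by
    rw [transFwd_zero_succ]
    exact (hA k hk).mul (isUnit_transFwd hA k (by lia))

/-- Invertibility of the factors plays no role: the total matrix inverse reverses products
unconditionally. -/
lemma transBwd_zero (A : ℕ → Matrix (Fin n) (Fin n) ℝ) :
    ∀ k, transBwd A 0 k = (transFwd A 0 k)⁻¹
  | 0 => by simp [transBwd, transFwd]
  | k + 1 => by
    rw [transFwd_zero_succ, Matrix.mul_inv_rev, ← transBwd_zero A k]
    simp [transBwd]

lemma transition_zero (A : ℕ → Matrix (Fin n) (Fin n) ℝ) (k : ℕ) :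
    transition A 0 k = (transFwd A 0 k)⁻¹ := by
  rw [← transBwd_zero]
  rcases Nat.eq_zero_or_pos k with rfl | hk
  · simp [transition, transFwd, transBwd]
  · simp [transition, hk.ne']

lemma transFwd_add (A : ℕ → Matrix (Fin n) (Fin n) ℝ) (l : ℕ) :
    ∀ j, transFwd A 0 (l + j) = transFwd A l j * transFwd A 0 l
  | 0 => by simp [transFwd]
  | j + 1 => by
    rw [← add_assoc, transFwd_zero_succ, transFwd_add A l j]
    simp [transFwd, Matrix.mul_assoc]

lemma transition_of_le (hA : ∀ k < N, IsUnit (A k)) {l : ℕ} (hl : l ≤ N) :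
    transition A N l = transFwd A 0 N * (transFwd A 0 l)⁻¹ := by
  have h := transFwd_add A l (N - l)
  rw [Nat.add_sub_cancel' hl] at h
  rw [h, Matrix.mul_assoc, mul_inv_of_isUnit (isUnit_transFwd hA l hl), Matrix.mul_one,
    transition, if_pos hl]

lemma reachGramian_eq (hA : ∀ k < N, IsUnit (A k)) :
    reachGramian A B N 0 = transFwd A 0 N * ctrlGramian A B N 0 * (transFwd A 0 N)ᵀ := by
  rw [reachGramian, ctrlGramian, Finset.mul_sum, Finset.sum_mul]
  refine Finset.sum_congr rfl fun k hk => ?_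
  rw [transition_of_le hA (by simpa using hk), transition_zero]
  simp [transpose_mul, Matrix.mul_assoc]

lemma ctrlGramian_succ (A : ℕ → Matrix (Fin n) (Fin n) ℝ) (B : ℕ → Matrix (Fin n) (Fin m) ℝ)
    (k : ℕ) : ctrlGramian A B (k + 1) 0 = ctrlGramian A B k 0 +
      ((transFwd A 0 (k + 1))⁻¹ * B k) * ((transFwd A 0 (k + 1))⁻¹ * B k)ᵀ := by
  rw [ctrlGramian, Finset.sum_Ico_succ_top (Nat.zero_le k), ctrlGramian, transition_zero]
  simp [transpose_mul, Matrix.mul_assoc]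

lemma ctrlGramian_sub_posSemidef (A : ℕ → Matrix (Fin n) (Fin n) ℝ)
    (B : ℕ → Matrix (Fin n) (Fin m) ℝ) {k : ℕ} :
    ∀ l, k ≤ l → (ctrlGramian A B l 0 - ctrlGramian A B k 0).PosSemidef := by
  intro l hl
  induction l, hl using Nat.le_induction with
  | base => rw [sub_self]; exact PosSemidef.zero
  | succ l hl ih =>
    rw [ctrlGramian_succ, add_sub_right_comm]
    exact ih.add (mul_transpose_posSemidef _)

lemma ctrlGramian_posSemidef (A : ℕ → Matrix (Fin n) (Fin n) ℝ)
    (B : ℕ → Matrix (Fin n) (Fin m) ℝ) (k : ℕ) : (ctrlGramian A B k 0).PosSemidef := by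
  have := ctrlGramian_sub_posSemidef A B k (Nat.zero_le k)
  simpa [ctrlGramian] using this

/-- The two Gramians are congruent by `Φ(N,0)`, and a positive semidefinite invertible matrix is
positive definite. -/
lemma ctrlGramian_posDef (hA : ∀ k < N, IsUnit (A k)) (h : IsUnit (reachGramian A B N 0)) :
    (ctrlGramian A B N 0).PosDef := by
  rw [(ctrlGramian_posSemidef A B N).posDef_iff_isUnit]
  rw [reachGramian_eq hA, isUnit_iff_isUnit_det, det_mul, det_mul] at h
  rw [isUnit_iff_isUnit_det]
  exact isUnit_of_mul_isUnit_right (isUnit_of_mul_isUnit_left h)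

/-! ### Scaled boundary data, the factor `L` and the defect `D`. -/

lemma sqrt_mul_sqrt_of_posDef {M : Matrix (Fin n) (Fin n) ℝ} (hM : M.PosDef) :
    CFC.sqrt M * CFC.sqrt M = M :=
  CFC.sqrt_mul_sqrt_self M hM.posSemidef.nonneg

lemma sqrt_posDef {M : Matrix (Fin n) (Fin n) ℝ} (hM : M.PosDef) : (CFC.sqrt M).PosDef := by
  have h0 : (CFC.sqrt M).PosSemidef := nonneg_iff_posSemidef.1 (CFC.sqrt_nonneg M)
  rw [h0.posDef_iff_isUnit, CFC.isUnit_sqrt_iff M hM.posSemidef.nonneg]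
  exact hM.isUnit

lemma mul_mul_self_posDef {M C : Matrix (Fin n) (Fin n) ℝ} (hM : M.PosDef) (hC : C.PosDef) :
    (C * M * C).PosDef := by
  simpa [transpose_eq_of_posDef hC] using mul_mul_transpose_posDef hM hC.isUnit

/-- The factor `L = G_c^{1/2} S₀^{1/2}` of `ε⁻¹ Σ₀ = L Lᵀ`. -/
noncomputable def initFactor (A : ℕ → Matrix (Fin n) (Fin n) ℝ) (B : ℕ → Matrix (Fin n) (Fin m) ℝ)
    (N : ℕ) (ε : ℝ) (Sig₀ : Matrix (Fin n) (Fin n) ℝ) : Matrix (Fin n) (Fin n) ℝ :=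
  CFC.sqrt (ctrlGramian A B N 0) * CFC.sqrt (scaledInit A B N ε Sig₀)

lemma scaledInit_posDef (hε : 0 < ε) (hG : (ctrlGramian A B N 0).PosDef) (h₀ : Sig₀.PosDef) :
    (scaledInit A B N ε Sig₀).PosDef :=
  (mul_mul_self_posDef h₀ (sqrt_posDef hG).inv).smul (inv_pos.2 hε)

lemma scaledFinal_posDef (hε : 0 < ε) (hA : ∀ k < N, IsUnit (A k))
    (hG : (ctrlGramian A B N 0).PosDef) (hN : SigN.PosDef) :
    (scaledFinal A B N ε SigN).PosDef := by
  refine (mul_mul_self_posDef (mul_mul_transpose_posDef hN ?_) (sqrt_posDef hG).inv).smul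
    (inv_pos.2 hε)
  rw [transition_zero, isUnit_nonsing_inv_iff]
  exact isUnit_transFwd hA N le_rfl

lemma initFactor_isUnit (hε : 0 < ε) (hG : (ctrlGramian A B N 0).PosDef) (h₀ : Sig₀.PosDef) :
    IsUnit (initFactor A B N ε Sig₀) :=
  (sqrt_posDef hG).isUnit.mul (sqrt_posDef (scaledInit_posDef hε hG h₀)).isUnit

lemma initFactor_transpose (hε : 0 < ε) (hG : (ctrlGramian A B N 0).PosDef)
    (h₀ : Sig₀.PosDef) : (initFactor A B N ε Sig₀)ᵀ =
      CFC.sqrt (scaledInit A B N ε Sig₀) * CFC.sqrt (ctrlGramian A B N 0) := by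
  rw [initFactor, transpose_mul, transpose_eq_of_posDef (sqrt_posDef hG),
    transpose_eq_of_posDef (sqrt_posDef (scaledInit_posDef hε hG h₀))]

lemma inv_eq_inv_sqrt_mul {M : Matrix (Fin n) (Fin n) ℝ} (hM : M.PosDef) :
    M⁻¹ = (CFC.sqrt M)⁻¹ * (CFC.sqrt M)⁻¹ := by
  rw [← Matrix.mul_inv_rev, sqrt_mul_sqrt_of_posDef hM]

lemma initFactor_mul_transpose (hε : 0 < ε) (hG : (ctrlGramian A B N 0).PosDef)
    (h₀ : Sig₀.PosDef) :
    initFactor A B N ε Sig₀ * (initFactor A B N ε Sig₀)ᵀ = ε⁻¹ • Sig₀ := by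
  rw [initFactor_transpose hε hG h₀, initFactor]
  set r := CFC.sqrt (ctrlGramian A B N 0) with hr
  have hu : IsUnit r := (sqrt_posDef hG).isUnit
  set S := scaledInit A B N ε Sig₀ with hS
  calc r * CFC.sqrt S * (CFC.sqrt S * r) = r * (CFC.sqrt S * CFC.sqrt S) * r := by
        simp only [Matrix.mul_assoc]
    _ = ε⁻¹ • ((r * r⁻¹) * Sig₀ * (r⁻¹ * r)) := by
        rw [sqrt_mul_sqrt_of_posDef (scaledInit_posDef hε hG h₀), scaledInit, ← hr]
        simp only [Matrix.mul_smul, Matrix.smul_mul, Matrix.mul_assoc]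
    _ = _ := by rw [mul_inv_of_isUnit hu, inv_mul_of_isUnit hu, Matrix.one_mul, Matrix.mul_one]

lemma initFactor_transpose_mul_inv (hε : 0 < ε) (hG : (ctrlGramian A B N 0).PosDef)
    (h₀ : Sig₀.PosDef) :
    (initFactor A B N ε Sig₀)ᵀ * (ctrlGramian A B N 0)⁻¹ =
      CFC.sqrt (scaledInit A B N ε Sig₀) * (CFC.sqrt (ctrlGramian A B N 0))⁻¹ := by
  rw [initFactor_transpose hε hG h₀, inv_eq_inv_sqrt_mul hG, Matrix.mul_assoc,
    ← Matrix.mul_assoc (CFC.sqrt (ctrlGramian A B N 0)),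
    mul_inv_of_isUnit (sqrt_posDef hG).isUnit, Matrix.one_mul]

lemma inv_mul_initFactor (hε : 0 < ε) (hG : (ctrlGramian A B N 0).PosDef)
    (h₀ : Sig₀.PosDef) :
    (ctrlGramian A B N 0)⁻¹ * initFactor A B N ε Sig₀ =
      (CFC.sqrt (ctrlGramian A B N 0))⁻¹ * CFC.sqrt (scaledInit A B N ε Sig₀) := by
  have h := congrArg transpose (initFactor_transpose_mul_inv hε hG h₀)
  simpa [transpose_mul, transpose_nonsing_inv, transpose_eq_of_posDef hG,
    transpose_eq_of_posDef (sqrt_posDef hG),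
    transpose_eq_of_posDef (sqrt_posDef (scaledInit_posDef hε hG h₀))] using h

lemma initFactor_conj_inv (hε : 0 < ε) (hG : (ctrlGramian A B N 0).PosDef)
    (h₀ : Sig₀.PosDef) :
    (initFactor A B N ε Sig₀)ᵀ * (ctrlGramian A B N 0)⁻¹ * initFactor A B N ε Sig₀ =
      scaledInit A B N ε Sig₀ := by
  rw [initFactor_transpose_mul_inv hε hG h₀, initFactor, Matrix.mul_assoc,
    ← Matrix.mul_assoc (CFC.sqrt (ctrlGramian A B N 0))⁻¹,
    inv_mul_of_isUnit (sqrt_posDef hG).isUnit, Matrix.one_mul,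
    sqrt_mul_sqrt_of_posDef (scaledInit_posDef hε hG h₀)]

/-- `R - I/2` with `R = (S₀^{1/2} S_N S₀^{1/2} + I/4)^{1/2}`. -/
noncomputable def midDefect (S₀ SN : Matrix (Fin n) (Fin n) ℝ) : Matrix (Fin n) (Fin n) ℝ :=
  midRoot S₀ SN - (1 / 2 : ℝ) • 1

lemma midRoot_mul_self {S₀ SN : Matrix (Fin n) (Fin n) ℝ} (h₀ : S₀.PosDef) (hN : SN.PosDef) :
    midRoot S₀ SN * midRoot S₀ SN =
      CFC.sqrt S₀ * SN * CFC.sqrt S₀ + (1 / 4 : ℝ) • (1 : Matrix (Fin n) (Fin n) ℝ) :=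
  sqrt_mul_sqrt_of_posDef ((mul_mul_self_posDef hN (sqrt_posDef h₀)).add
    (PosDef.one.smul (by norm_num)))

lemma midDefect_posDef {S₀ SN : Matrix (Fin n) (Fin n) ℝ} (h₀ : S₀.PosDef) (hN : SN.PosDef) :
    (midDefect S₀ SN).PosDef :=
  posDef_sub_half (nonneg_iff_posSemidef.1 (CFC.sqrt_nonneg _))
    (mul_mul_self_posDef hN (sqrt_posDef h₀)) (midRoot_mul_self h₀ hN)

lemma midDefect_mul_self_add {S₀ SN : Matrix (Fin n) (Fin n) ℝ} (h₀ : S₀.PosDef)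
    (hN : SN.PosDef) : midDefect S₀ SN * midDefect S₀ SN + midDefect S₀ SN =
      CFC.sqrt S₀ * SN * CFC.sqrt S₀ := by
  have h := midRoot_mul_self h₀ hN
  rw [midDefect, Matrix.mul_sub, Matrix.sub_mul, h]
  simp only [Matrix.mul_smul, Matrix.smul_mul, Matrix.mul_one, Matrix.one_mul]
  module

/-- As `Lᵀ G⁻¹ L = S₀`, this puts `F` in the form required by the boundary lemmas. -/
lemma calF_eq (hε : 0 < ε) (hG : (ctrlGramian A B N 0).PosDef) (h₀ : Sig₀.PosDef) :
    calF (scaledInit A B N ε Sig₀) (scaledFinal A B N ε SigN) =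
      (initFactor A B N ε Sig₀)ᵀ * (ctrlGramian A B N 0)⁻¹ * initFactor A B N ε Sig₀ -
        midDefect (scaledInit A B N ε Sig₀) (scaledFinal A B N ε SigN) := by
  rw [initFactor_conj_inv hε hG h₀, calF, midDefect]
  abel

lemma QminusInit_eq (hε : 0 < ε) (hG : (ctrlGramian A B N 0).PosDef) (h₀ : Sig₀.PosDef) :
    QminusInit A B N ε Sig₀ SigN = initFactor A B N ε Sig₀ *
      ((initFactor A B N ε Sig₀)ᵀ * (ctrlGramian A B N 0)⁻¹ * initFactor A B N ε Sig₀ -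
        midDefect (scaledInit A B N ε Sig₀) (scaledFinal A B N ε SigN))⁻¹ *
      (initFactor A B N ε Sig₀)ᵀ := by
  rw [← calF_eq hε hG h₀, initFactor_transpose hε hG h₀, initFactor, QminusInit, calF]
  simp only [Matrix.mul_assoc]

/-! ### Invertibility of `Q₋` and positivity of the gain matrices. -/

lemma Qminus_eq (hA : ∀ k < N, IsUnit (A k)) : ∀ k ≤ N, Qminus A B N ε Sig₀ SigN k =
    transFwd A 0 k * (QminusInit A B N ε Sig₀ SigN - ctrlGramian A B k 0) * (transFwd A 0 k)ᵀ
  | 0, _ => by simp [Qminus, transFwd, ctrlGramian]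
  | k + 1, hk => by
    have hu := isUnit_transFwd hA (k + 1) hk
    set q := QminusInit A B N ε Sig₀ SigN
    have hB : transFwd A 0 (k + 1) * ((transFwd A 0 (k + 1))⁻¹ * B k) = B k := by
      rw [← Matrix.mul_assoc, mul_inv_of_isUnit hu, Matrix.one_mul]
    rw [Qminus, Qminus_eq hA k (by lia), ctrlGramian_succ, ← sub_sub, Matrix.mul_sub _ (_ - _),
      Matrix.sub_mul]
    congr 1
    · rw [transFwd_zero_succ, transpose_mul]
      simp only [Matrix.mul_assoc]
      rfl
    · conv_lhs => rw [← hB, transpose_mul]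
      simp only [Matrix.mul_assoc]

lemma QminusInit_transpose (hε : 0 < ε) (hG : (ctrlGramian A B N 0).PosDef)
    (h₀ : Sig₀.PosDef) :
    (QminusInit A B N ε Sig₀ SigN)ᵀ = QminusInit A B N ε Sig₀ SigN := by
  rw [QminusInit_eq hε hG h₀, initFactor_conj_inv hε hG h₀]
  simp [transpose_mul, transpose_nonsing_inv, Matrix.mul_assoc, midDefect, midRoot,
    transpose_eq_of_posSemidef (nonneg_iff_posSemidef.1 (CFC.sqrt_nonneg _)),
    transpose_eq_of_posDef (scaledInit_posDef hε hG h₀)]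

lemma Qminus_transpose (hε : 0 < ε) (hG : (ctrlGramian A B N 0).PosDef) (h₀ : Sig₀.PosDef) :
    ∀ k, (Qminus A B N ε Sig₀ SigN k)ᵀ = Qminus A B N ε Sig₀ SigN k
  | 0 => QminusInit_transpose hε hG h₀
  | k + 1 => by
    simp [Qminus, transpose_mul, Qminus_transpose hε hG h₀ k, Matrix.mul_assoc]

lemma isUnit_QminusInit_sub (hε : 0 < ε) (hA : ∀ k < N, IsUnit (A k))
    (hG : (ctrlGramian A B N 0).PosDef) (h₀ : Sig₀.PosDef) (h₁ : SigN.PosDef)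
    (hF : IsUnit (calF (scaledInit A B N ε Sig₀) (scaledFinal A B N ε SigN)))
    {g : Matrix (Fin n) (Fin n) ℝ} (hg : g.PosSemidef)
    (hgG : (ctrlGramian A B N 0 - g).PosSemidef) :
    IsUnit (QminusInit A B N ε Sig₀ SigN - g) := by
  have hL := initFactor_isUnit hε hG h₀
  refine isUnit_sub_of_le (T := ((initFactor A B N ε Sig₀)⁻¹)ᵀ *
    midDefect (scaledInit A B N ε Sig₀) (scaledFinal A B N ε SigN) *
      (initFactor A B N ε Sig₀)⁻¹) hG ?_ ?_ hg hgG
  · have := mul_mul_transpose_posDef (midDefect_posDef (scaledInit_posDef hε hG h₀)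
      (scaledFinal_posDef hε hA hG h₁))
      ((isUnit_transpose _).2 (isUnit_nonsing_inv_iff.2 hL))
    rwa [transpose_transpose] at this
  · rw [QminusInit_eq hε hG h₀]
    rw [calF_eq hε hG h₀] at hF
    exact inv_boundary_mul hL hF

lemma Qminus_isUnit (hε : 0 < ε) (hA : ∀ k < N, IsUnit (A k))
    (hG : (ctrlGramian A B N 0).PosDef) (h₀ : Sig₀.PosDef) (h₁ : SigN.PosDef)
    (hF : IsUnit (calF (scaledInit A B N ε Sig₀) (scaledFinal A B N ε SigN)))
    {k : ℕ} (hk : k ≤ N) : IsUnit (Qminus A B N ε Sig₀ SigN k) := by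
  rw [Qminus_eq hA k hk]
  have hu := isUnit_transFwd hA k hk
  exact (hu.mul (isUnit_QminusInit_sub hε hA hG h₀ h₁ hF (ctrlGramian_posSemidef A B k)
    (ctrlGramian_sub_posSemidef A B N hk))).mul ((isUnit_transpose _).2 hu)

/-- Pulled back to time 0, `Q_{-,k+1} + t B_k B_kᵀ` is `q₀ - g` with `g` on the segment from
`G_c(k+1,0)` at `t = 0` to `G_c(k,0)` at `t = 1`. Throughout, `0 ≤ g ≤ G_c(N,0)`, so invertibility
holds for all `t` in `[0, 1]`. -/
lemma gainMatrix_posDef (hε : 0 < ε) (hA : ∀ k < N, IsUnit (A k))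
    (hG : (ctrlGramian A B N 0).PosDef) (h₀ : Sig₀.PosDef) (h₁ : SigN.PosDef)
    (hF : IsUnit (calF (scaledInit A B N ε Sig₀) (scaledFinal A B N ε SigN)))
    {k : ℕ} (hk : k < N) : (gainMatrix A B N ε Sig₀ SigN k).PosDef := by
  refine posDef_one_add_of_isUnit (B k) (Qminus_transpose hε hG h₀ _) fun t ht0 ht1 => ?_
  have hu := isUnit_transFwd hA (k + 1) hk
  set b := (transFwd A 0 (k + 1))⁻¹ * B k with hb
  have hB : transFwd A 0 (k + 1) * b = B k := by
    rw [hb, ← Matrix.mul_assoc, mul_inv_of_isUnit hu, Matrix.one_mul]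
  have hg := ctrlGramian_succ A B k
  rw [← hb] at hg
  have key : Qminus A B N ε Sig₀ SigN (k + 1) + t • (B k * (B k)ᵀ) = transFwd A 0 (k + 1) *
      (QminusInit A B N ε Sig₀ SigN - (ctrlGramian A B (k + 1) 0 - t • (b * bᵀ))) *
        (transFwd A 0 (k + 1))ᵀ := by
    rw [Qminus_eq hA (k + 1) hk, ← sub_add, Matrix.mul_add, Matrix.add_mul]
    congr 1
    rw [← hB, transpose_mul]
    simp only [Matrix.mul_assoc, Matrix.mul_smul, Matrix.smul_mul]
  rw [key]
  refine (hu.mul (isUnit_QminusInit_sub hε hA hG h₀ h₁ hF ?_ ?_)).mul ((isUnit_transpose _).2 hu)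
  · have : ctrlGramian A B (k + 1) 0 - t • (b * bᵀ) =
        ctrlGramian A B k 0 + (1 - t) • (b * bᵀ) := by rw [hg]; module
    rw [this]
    exact (ctrlGramian_posSemidef A B k).add
      ((mul_transpose_posSemidef b).smul (sub_nonneg.2 ht1))
  · rw [← sub_add]
    exact (ctrlGramian_sub_posSemidef A B N (Nat.succ_le_of_lt hk)).add
      ((mul_transpose_posSemidef b).smul ht0)

/-- The feedback gain of the optimal policy. -/
noncomputable def optGain (A : ℕ → Matrix (Fin n) (Fin n) ℝ) (B : ℕ → Matrix (Fin n) (Fin m) ℝ)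
    (N : ℕ) (ε : ℝ) (Sig₀ SigN : Matrix (Fin n) (Fin n) ℝ) (k : ℕ) :
    Matrix (Fin m) (Fin n) ℝ :=
  (gainMatrix A B N ε Sig₀ SigN k)⁻¹ * (B k)ᵀ * (Qminus A B N ε Sig₀ SigN (k + 1))⁻¹ * A k

/-- The weight `q₀⁻¹ - q₀⁻¹ (ε⁻¹ Σ₀) q₀⁻¹`, with `q₀ = Q₋,₀`, transported to time `k`. -/
noncomputable def covWeight (A : ℕ → Matrix (Fin n) (Fin n) ℝ)
    (B : ℕ → Matrix (Fin n) (Fin m) ℝ)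
    (N : ℕ) (ε : ℝ) (Sig₀ SigN : Matrix (Fin n) (Fin n) ℝ) : ℕ → Matrix (Fin n) (Fin n) ℝ
  | 0 => (QminusInit A B N ε Sig₀ SigN)⁻¹ -
      (QminusInit A B N ε Sig₀ SigN)⁻¹ * (ε⁻¹ • Sig₀) * (QminusInit A B N ε Sig₀ SigN)⁻¹
  | k + 1 => ((A k)⁻¹)ᵀ * covWeight A B N ε Sig₀ SigN k * (A k)⁻¹

/-- The covariance of the state at time `k` under the optimal policy. -/
noncomputable def optCov (A : ℕ → Matrix (Fin n) (Fin n) ℝ) (B : ℕ → Matrix (Fin n) (Fin m) ℝ)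
    (N : ℕ) (ε : ℝ) (Sig₀ SigN : Matrix (Fin n) (Fin n) ℝ) (k : ℕ) : Matrix (Fin n) (Fin n) ℝ :=
  ε • (Qminus A B N ε Sig₀ SigN k - Qminus A B N ε Sig₀ SigN k *
    covWeight A B N ε Sig₀ SigN k * Qminus A B N ε Sig₀ SigN k)

lemma covWeight_eq : ∀ k, covWeight A B N ε Sig₀ SigN k =
    ((transFwd A 0 k)⁻¹)ᵀ * covWeight A B N ε Sig₀ SigN 0 * (transFwd A 0 k)⁻¹
  | 0 => by simp [transFwd]
  | k + 1 => by
    rw [show covWeight A B N ε Sig₀ SigN (k + 1) =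
      ((A k)⁻¹)ᵀ * covWeight A B N ε Sig₀ SigN k * (A k)⁻¹ from rfl,
      covWeight_eq k, transFwd_zero_succ, Matrix.mul_inv_rev, transpose_mul]
    simp only [Matrix.mul_assoc]

lemma optCov_zero (hε : 0 < ε) (hu : IsUnit (QminusInit A B N ε Sig₀ SigN)) :
    optCov A B N ε Sig₀ SigN 0 = Sig₀ := by
  have h1 := mul_inv_of_isUnit hu
  have h2 := inv_mul_of_isUnit hu
  rw [optCov, Qminus, covWeight]
  set q := QminusInit A B N ε Sig₀ SigN
  have : q * (q⁻¹ - q⁻¹ * (ε⁻¹ • Sig₀) * q⁻¹) * q = q - ε⁻¹ • Sig₀ := by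
    calc q * (q⁻¹ - q⁻¹ * (ε⁻¹ • Sig₀) * q⁻¹) * q =
        (q * q⁻¹) * q - (q * q⁻¹) * (ε⁻¹ • Sig₀) * (q⁻¹ * q) := by
          simp only [Matrix.mul_sub, Matrix.sub_mul, Matrix.mul_assoc]
      _ = _ := by rw [h1, h2, Matrix.one_mul, Matrix.one_mul, Matrix.mul_one]
  rw [this, sub_sub_cancel, smul_smul, mul_inv_cancel₀ hε.ne', one_smul]

lemma optCov_final (hε : 0 < ε) (hA : ∀ k < N, IsUnit (A k))
    (hG : (ctrlGramian A B N 0).PosDef) (h₀ : Sig₀.PosDef) (h₁ : SigN.PosDef)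
    (hF : IsUnit (calF (scaledInit A B N ε Sig₀) (scaledFinal A B N ε SigN))) :
    optCov A B N ε Sig₀ SigN N = SigN := by
  have hu := isUnit_transFwd hA N le_rfl
  have hL := initFactor_isUnit hε hG h₀
  have hS₀ := scaledInit_posDef hε hG h₀
  have hSN := scaledFinal_posDef hε hA hG h₁
  rw [calF_eq hε hG h₀] at hF
  have hD : midDefect (scaledInit A B N ε Sig₀) (scaledFinal A B N ε SigN) *
      midDefect (scaledInit A B N ε Sig₀) (scaledFinal A B N ε SigN) +
      midDefect (scaledInit A B N ε Sig₀) (scaledFinal A B N ε SigN) =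
      (initFactor A B N ε Sig₀)ᵀ * (ctrlGramian A B N 0)⁻¹ *
        (ε⁻¹ • ((transFwd A 0 N)⁻¹ * SigN * ((transFwd A 0 N)⁻¹)ᵀ)) *
        (ctrlGramian A B N 0)⁻¹ * initFactor A B N ε Sig₀ := by
    rw [midDefect_mul_self_add hS₀ hSN, Matrix.mul_assoc _ (ctrlGramian A B N 0)⁻¹
      (initFactor A B N ε Sig₀), inv_mul_initFactor hε hG h₀,
      initFactor_transpose_mul_inv hε hG h₀]
    conv_lhs => rw [scaledFinal, transition_zero]
    simp only [Matrix.mul_smul, Matrix.smul_mul, Matrix.mul_assoc]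
  have key := boundary_final hL hG.isUnit hF hD (QminusInit_eq hε hG h₀)
  rw [initFactor_mul_transpose hε hG h₀] at key
  rw [optCov, covWeight_eq, Qminus_eq hA N le_rfl, covWeight]
  set P := transFwd A 0 N
  have hP : P⁻¹ * P = 1 := inv_mul_of_isUnit hu
  have hP' : P * P⁻¹ = 1 := mul_inv_of_isUnit hu
  have hPt : Pᵀ * (P⁻¹)ᵀ = 1 := by rw [← transpose_mul, hP, transpose_one]
  have hPt' : (P⁻¹)ᵀ * Pᵀ = 1 := by rw [← transpose_mul, hP', transpose_one]
  set q := QminusInit A B N ε Sig₀ SigN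
  set r := q - ctrlGramian A B N 0
  set w := q⁻¹ - q⁻¹ * (ε⁻¹ • Sig₀) * q⁻¹
  calc ε • (P * r * Pᵀ - P * r * Pᵀ * ((P⁻¹)ᵀ * w * P⁻¹) * (P * r * Pᵀ))
      = ε • (P * r * Pᵀ - P * r * (Pᵀ * (P⁻¹)ᵀ) * w * (P⁻¹ * P) * r * Pᵀ) := by
        simp only [Matrix.mul_assoc]
    _ = ε • (P * (r - r * w * r) * Pᵀ) := by
        rw [hP, hPt]
        simp only [Matrix.mul_sub, Matrix.sub_mul, Matrix.mul_assoc, Matrix.one_mul]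
    _ = (P * P⁻¹) * SigN * ((P⁻¹)ᵀ * Pᵀ) := by
        rw [key]
        simp only [Matrix.mul_smul, Matrix.smul_mul, Matrix.mul_assoc, smul_smul,
          mul_inv_cancel₀ hε.ne', one_smul]
    _ = SigN := by rw [hP', hPt', Matrix.one_mul, Matrix.mul_one]

lemma optCov_succ (hε : 0 < ε) (hA : ∀ k < N, IsUnit (A k))
    (hG : (ctrlGramian A B N 0).PosDef) (h₀ : Sig₀.PosDef) (h₁ : SigN.PosDef)
    (hF : IsUnit (calF (scaledInit A B N ε Sig₀) (scaledFinal A B N ε SigN)))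
    {k : ℕ} (hk : k < N) : optCov A B N ε Sig₀ SigN (k + 1) =
      (A k - B k * optGain A B N ε Sig₀ SigN k) * optCov A B N ε Sig₀ SigN k *
        (A k - B k * optGain A B N ε Sig₀ SigN k)ᵀ +
      B k * (ε • (gainMatrix A B N ε Sig₀ SigN k)⁻¹) * (B k)ᵀ := by
  have h := closedLoop_covariance (B := B k) (covWeight A B N ε Sig₀ SigN k) (hA k hk)
    (Qminus_isUnit hε hA hG h₀ h₁ hF hk) (Qminus_transpose hε hG h₀ k)
    (Qminus_transpose hε hG h₀ (k + 1)) (gainMatrix_posDef hε hA hG h₀ h₁ hF hk).isUnit rfl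
  rw [optCov, covWeight, ← h, optCov]
  simp only [Matrix.mul_smul, Matrix.smul_mul, ← smul_add]
  rfl

/-- Definiteness is not visible in the formula `Q - Q W Q`. It propagates from `Σ₀` because the
closed-loop matrix is invertible and the noise only adds a semidefinite term. -/
lemma optCov_posDef (hε : 0 < ε) (hA : ∀ k < N, IsUnit (A k))
    (hG : (ctrlGramian A B N 0).PosDef) (h₀ : Sig₀.PosDef) (h₁ : SigN.PosDef)
    (hF : IsUnit (calF (scaledInit A B N ε Sig₀) (scaledFinal A B N ε SigN))) :
    ∀ k ≤ N, (optCov A B N ε Sig₀ SigN k).PosDef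
  | 0, hk => by
    rw [optCov_zero hε (Qminus_isUnit hε hA hG h₀ h₁ hF hk)]
    exact h₀
  | k + 1, hk => by
    rw [optCov_succ hε hA hG h₀ h₁ hF hk]
    have hΓ := gainMatrix_posDef hε hA hG h₀ h₁ hF (k := k) hk
    refine (mul_mul_transpose_posDef (optCov_posDef hε hA hG h₀ h₁ hF k (by lia)) ?_).add_posSemidef
      (mul_mul_transpose_posSemidef (hΓ.inv.smul hε).posSemidef _)
    exact closedLoop_isUnit (hA k hk) (Qminus_isUnit hε hA hG h₀ h₁ hF (by lia))
      (Qminus_isUnit hε hA hG h₀ h₁ hF hk) hΓ.isUnit rfl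

end System

/-! ### Densities of nondegenerate Gaussian measures. -/

section Gaussian

variable {n m : ℕ}

lemma gaussianDensity_pos {S : Matrix (Fin m) (Fin m) ℝ} (hS : S.PosDef)
    (μ u : EuclideanSpace ℝ (Fin m)) : 0 < gaussianDensity μ S u := by
  have := hS.det_pos
  unfold gaussianDensity
  positivity

lemma continuous_gaussianDensity {X : Type*} [TopologicalSpace X]
    {f g : X → EuclideanSpace ℝ (Fin m)} (hf : Continuous f) (hg : Continuous g)
    (S : Matrix (Fin m) (Fin m) ℝ) : Continuous fun x => gaussianDensity (f x) S (g x) := by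
  unfold gaussianDensity
  have h : Continuous fun x => (g x - f x).ofLp :=
    (PiLp.continuous_ofLp 2 _).comp (hg.sub hf)
  exact continuous_const.mul (Real.continuous_exp.comp (continuous_const.mul
    (h.dotProduct (continuous_const.matrix_mulVec h))))

lemma measurable_gaussianDensity (μ : EuclideanSpace ℝ (Fin m)) (S : Matrix (Fin m) (Fin m) ℝ) :
    Measurable (gaussianDensity μ S) :=
  (continuous_gaussianDensity continuous_const continuous_id S).measurable

lemma dotProduct_self_eq_norm_sq (z : EuclideanSpace ℝ (Fin m)) : z.ofLp ⬝ᵥ z.ofLp = ‖z‖ ^ 2 := by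
  rw [EuclideanSpace.real_norm_sq_eq]
  simp [dotProduct, sq]

lemma gaussianDensity_zero_one (z : EuclideanSpace ℝ (Fin m)) :
    gaussianDensity 0 1 z =
      (Real.sqrt ((2 * Real.pi) ^ m))⁻¹ * Real.exp (-(1 / 2 : ℝ) * ‖z‖ ^ 2) := by
  simp [gaussianDensity, dotProduct_self_eq_norm_sq]

lemma integrable_gaussianDensity_zero_one :
    Integrable (gaussianDensity (0 : EuclideanSpace ℝ (Fin m)) 1) := by
  have h := GaussianFourier.integrable_cexp_neg_mul_sq_norm_add
    (V := EuclideanSpace ℝ (Fin m)) (b := (1 / 2 : ℂ)) (by norm_num) 0 0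
  have h2 := h.re.const_mul (Real.sqrt ((2 * Real.pi) ^ m))⁻¹
  refine h2.congr (Filter.Eventually.of_forall fun z => ?_)
  simp only [gaussianDensity_zero_one]
  congr 1
  have : (-(1 / 2 : ℂ) * (‖z‖ : ℂ) ^ 2 + 0 * ((inner ℝ (0 : EuclideanSpace ℝ (Fin m)) z : ℝ) : ℂ)) =
      ((-(1 / 2 : ℝ) * ‖z‖ ^ 2 : ℝ) : ℂ) := by push_cast; ring
  rw [this, ← Complex.ofReal_exp]
  exact Complex.ofReal_re _

lemma charFun_withDensity_gaussianDensity (t : EuclideanSpace ℝ (Fin m)) :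
    charFun (volume.withDensity fun z => ENNReal.ofReal (gaussianDensity 0 1 z)) t =
      Complex.exp (-‖t‖ ^ 2 / 2) := by
  rw [charFun_apply, integral_withDensity_eq_integral_toReal_smul
    (measurable_gaussianDensity 0 1).ennreal_ofReal (by simp)]
  have h := GaussianFourier.integral_cexp_neg_mul_sq_norm_add
    (V := EuclideanSpace ℝ (Fin m)) (b := (1 / 2 : ℂ)) (by norm_num) Complex.I t
  have hint : ∀ z : EuclideanSpace ℝ (Fin m),
      (ENNReal.ofReal (gaussianDensity 0 1 z)).toReal •
        Complex.exp ((inner ℝ z t : ℝ) * Complex.I) =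
      (((Real.sqrt ((2 * Real.pi) ^ m))⁻¹ : ℝ) : ℂ) *
        Complex.exp (-(1 / 2 : ℂ) * ‖z‖ ^ 2 + Complex.I * (inner ℝ t z : ℝ)) := by
    intro z
    rw [ENNReal.toReal_ofReal (gaussianDensity_pos PosDef.one 0 z).le, gaussianDensity_zero_one,
      Complex.exp_add, Complex.real_smul, real_inner_comm, mul_comm Complex.I]
    push_cast
    ring
  simp_rw [hint]
  rw [integral_const_mul, h]
  have hpi : (((Real.sqrt ((2 * Real.pi) ^ m))⁻¹ : ℝ) : ℂ) *
      ((Real.pi : ℂ) / (1 / 2)) ^ ((Module.finrank ℝ (EuclideanSpace ℝ (Fin m)) : ℂ) / 2) = 1 := by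
    have h2 : ((Real.pi : ℂ) / (1 / 2)) ^
        ((Module.finrank ℝ (EuclideanSpace ℝ (Fin m)) : ℂ) / 2) =
        ((Real.sqrt ((2 * Real.pi) ^ m) : ℝ) : ℂ) := by
      rw [finrank_euclideanSpace, Fintype.card_fin, Real.sqrt_eq_rpow, ← Real.rpow_natCast,
        ← Real.rpow_mul (by positivity), Complex.ofReal_cpow (by positivity)]
      push_cast
      congr 1 <;> ring
    rw [h2, ← Complex.ofReal_mul, inv_mul_cancel₀ (by positivity), Complex.ofReal_one]
  rw [← mul_assoc, hpi, one_mul, Complex.I_sq]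
  congr 1
  ring

lemma stdGaussian_eq_withDensity : stdGaussian (EuclideanSpace ℝ (Fin m)) =
    volume.withDensity fun z => ENNReal.ofReal (gaussianDensity 0 1 z) := by
  have : IsFiniteMeasure ((volume : Measure (EuclideanSpace ℝ (Fin m))).withDensity
      fun z => ENNReal.ofReal (gaussianDensity 0 1 z)) :=
    isFiniteMeasure_withDensity_ofReal integrable_gaussianDensity_zero_one.2
  refine Measure.ext_of_charFun ?_
  ext t
  rw [charFun_stdGaussian, charFun_withDensity_gaussianDensity]

lemma ofLp_toEuclideanLin {p q : ℕ} (M : Matrix (Fin p) (Fin q) ℝ)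
    (x : EuclideanSpace ℝ (Fin q)) : (Matrix.toEuclideanLin M x).ofLp = M *ᵥ x.ofLp := rfl

lemma det_toEuclideanCLM (C : Matrix (Fin m) (Fin m) ℝ) :
    (toEuclideanCLM (𝕜 := ℝ) C : EuclideanSpace ℝ (Fin m) →L[ℝ] EuclideanSpace ℝ (Fin m)).det =
      C.det := by
  rw [ContinuousLinearMap.det, coe_toEuclideanCLM_eq_toEuclideanLin, Matrix.toEuclideanLin,
    toLpLin_eq_toLin, LinearMap.det_toLin]

/-- Change of variables from a Gaussian density to the standard one by a square root of the
covariance. -/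
lemma abs_det_mul_gaussianDensity {S C : Matrix (Fin m) (Fin m) ℝ} (hC : C.PosDef)
    (hCS : C * C = S) (μ z : EuclideanSpace ℝ (Fin m)) :
    |C.det| * gaussianDensity μ S (μ + toEuclideanCLM (𝕜 := ℝ) C z) = gaussianDensity 0 1 z := by
  have hdet := hC.det_pos
  have hq : (toEuclideanCLM (𝕜 := ℝ) C z).ofLp ⬝ᵥ S⁻¹ *ᵥ (toEuclideanCLM (𝕜 := ℝ) C z).ofLp =
      ‖z‖ ^ 2 := by
    have h1 : C * (S⁻¹ * C) = 1 := by
      rw [← hCS, Matrix.mul_inv_rev, ← Matrix.mul_assoc, ← Matrix.mul_assoc,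
        mul_inv_of_isUnit hC.isUnit, Matrix.one_mul, inv_mul_of_isUnit hC.isUnit]
    rw [ofLp_toEuclideanCLM, ← dotProduct_transpose_mulVec, transpose_eq_of_posDef hC,
      mulVec_mulVec, mulVec_mulVec, Matrix.mul_assoc, h1, one_mulVec, dotProduct_self_eq_norm_sq]
  rw [gaussianDensity_zero_one, gaussianDensity, add_sub_cancel_left, hq, ← mul_assoc]
  congr 1
  rw [← hCS, det_mul, Real.sqrt_mul (by positivity), Real.sqrt_mul_self hdet.le,
    abs_of_pos hdet]
  field_simp

/-- The measure is the image of the standard Gaussian, whose density is identified by its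
characteristic function, under `x ↦ μ + S^{1/2} x`. The density follows by change of variables, this
map being a bijection as `S` is definite. -/
lemma multivariateGaussian_eq_withDensity (μ : EuclideanSpace ℝ (Fin m))
    {S : Matrix (Fin m) (Fin m) ℝ} (hS : S.PosDef) :
    multivariateGaussian μ S = volume.withDensity fun u => ENNReal.ofReal (gaussianDensity μ S u) := by
  have hC := sqrt_posDef hS
  have hCS := sqrt_mul_sqrt_of_posDef hS
  rw [multivariateGaussian]
  set C := CFC.sqrt S
  set f : EuclideanSpace ℝ (Fin m) → EuclideanSpace ℝ (Fin m) :=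
    fun x => μ + toEuclideanCLM (𝕜 := ℝ) C x with hf
  have hfm : Measurable f := by fun_prop
  have hinj : Function.Injective f := by
    intro x y hxy
    have h1 : toEuclideanCLM (𝕜 := ℝ) C x = toEuclideanCLM (𝕜 := ℝ) C y := by simpa [hf] using hxy
    have h2 := congrArg WithLp.ofLp h1
    rw [ofLp_toEuclideanCLM, ofLp_toEuclideanCLM] at h2
    exact WithLp.ofLp_injective 2 (mulVec_injective_iff_isUnit.2 hC.isUnit h2)
  have hsurj : Function.Surjective f := by
    intro y
    refine ⟨WithLp.toLp 2 (C⁻¹ *ᵥ (y - μ).ofLp), ?_⟩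
    simp only [hf, toEuclideanCLM_toLp, mulVec_mulVec, mul_inv_of_isUnit hC.isUnit, one_mulVec]
    simp
  ext s hs
  rw [Measure.map_apply hfm hs, stdGaussian_eq_withDensity, withDensity_apply _ (hfm hs),
    withDensity_apply _ hs]
  conv_rhs => rw [← Set.image_preimage_eq s hsurj]
  rw [lintegral_image_eq_lintegral_abs_det_fderiv_mul volume (hfm hs)
    (fun x _ => ((toEuclideanCLM (𝕜 := ℝ) C).hasFDerivAt.const_add μ).hasFDerivWithinAt)
    hinj.injOn]
  refine lintegral_congr fun z => ?_
  rw [det_toEuclideanCLM, ← ENNReal.ofReal_mul (abs_nonneg _),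
    abs_det_mul_gaussianDensity hC hCS]

lemma lintegral_gaussianDensity (μ : EuclideanSpace ℝ (Fin m))
    {S : Matrix (Fin m) (Fin m) ℝ} (hS : S.PosDef) :
    ∫⁻ u, ENNReal.ofReal (gaussianDensity μ S u) = 1 := by
  have h := congrArg (fun ν => ν Set.univ) (multivariateGaussian_eq_withDensity μ hS)
  simpa using h.symm

lemma volume_absolutelyContinuous_multivariateGaussian (μ : EuclideanSpace ℝ (Fin m))
    {S : Matrix (Fin m) (Fin m) ℝ} (hS : S.PosDef) :
    (volume : Measure (EuclideanSpace ℝ (Fin m))) ≪ multivariateGaussian μ S := by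
  rw [multivariateGaussian_eq_withDensity μ hS]
  refine withDensity_absolutelyContinuous' (measurable_gaussianDensity μ S).ennreal_ofReal.aemeasurable
    (Filter.Eventually.of_forall fun u => ?_)
  simpa using gaussianDensity_pos hS μ u

lemma log_gaussianDensity {S : Matrix (Fin m) (Fin m) ℝ} (hS : S.PosDef)
    (μ u : EuclideanSpace ℝ (Fin m)) : Real.log (gaussianDensity μ S u) =
      -Real.log (Real.sqrt ((2 * Real.pi) ^ m * S.det)) -
        1 / 2 * ((u - μ).ofLp ⬝ᵥ S⁻¹ *ᵥ (u - μ).ofLp) := by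
  have := hS.det_pos
  rw [gaussianDensity, Real.log_mul (by positivity) (by positivity), Real.log_inv, Real.log_exp]
  ring

end Gaussian

/-! ### Gibbs' inequality. -/

section Gibbs

/-- For `p > 0` the expression is `p (r - 1 - log r)` with `r = q / p`. For `p = 0` it is `q > 0`,
by the convention `log 0 = 0`. -/
lemma relEntropy_integrand_nonneg {p q : ℝ} (hp : 0 ≤ p) (hq : 0 < q) :
    0 ≤ p * Real.log p - p * Real.log q - p + q ∧
      (p * Real.log p - p * Real.log q - p + q = 0 → p = q) := by
  rcases hp.eq_or_lt with rfl | hp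
  · simp [hq.le, hq.ne]
    exact hq.ne'
  have key : p * Real.log p - p * Real.log q - p + q =
      p * (q / p - 1 - Real.log (q / p)) := by
    rw [Real.log_div hq.ne' hp.ne']
    field_simp
    ring
  have hqp : 0 < q / p := div_pos hq hp
  rw [key]
  refine ⟨mul_nonneg hp.le (sub_nonneg.2 (Real.log_le_sub_one_of_pos hqp)), fun h => ?_⟩
  by_contra hne
  have h1 : q / p ≠ 1 := fun h1 => hne ((div_eq_one_iff_eq hp.ne').1 h1).symm
  have h2 := Real.log_lt_sub_one_of_pos hqp h1
  exact (mul_pos hp (sub_pos.2 h2)).ne' h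

variable {E : Type*} [MeasurableSpace E] {μ : Measure E} {p q : E → ℝ}

lemma integrable_of_lintegral_eq_one (hp : Measurable p) (hp0 : ∀ u, 0 ≤ p u)
    (h : ∫⁻ u, ENNReal.ofReal (p u) ∂μ = 1) : Integrable p μ ∧ ∫ u, p u ∂μ = 1 := by
  constructor
  · rw [← lintegral_ofReal_ne_top_iff_integrable hp.aestronglyMeasurable
      (Filter.Eventually.of_forall hp0), h]
    exact ENNReal.one_ne_top
  · rw [integral_eq_lintegral_of_nonneg_ae (Filter.Eventually.of_forall hp0)
      hp.aestronglyMeasurable, h, ENNReal.toReal_one]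

/-- Gibbs' inequality, with the case of equality. -/
lemma gibbs (hp : Measurable p) (hq : Measurable q) (hp0 : ∀ u, 0 ≤ p u) (hq0 : ∀ u, 0 < q u)
    (hp1 : ∫⁻ u, ENNReal.ofReal (p u) ∂μ = 1) (hq1 : ∫⁻ u, ENNReal.ofReal (q u) ∂μ = 1)
    (hpp : Integrable (fun u => p u * Real.log (p u)) μ)
    (hpq : Integrable (fun u => p u * Real.log (q u)) μ) :
    0 ≤ ∫ u, p u * Real.log (p u) ∂μ - ∫ u, p u * Real.log (q u) ∂μ ∧
      (∫ u, p u * Real.log (p u) ∂μ - ∫ u, p u * Real.log (q u) ∂μ = 0 → p =ᵐ[μ] q) := by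
  obtain ⟨hpi, hp1⟩ := integrable_of_lintegral_eq_one hp hp0 hp1
  obtain ⟨hqi, hq1⟩ := integrable_of_lintegral_eq_one hq (fun u => (hq0 u).le) hq1
  -- Adding `-p + q`, of integral zero, makes the integrand pointwise nonnegative.
  have hint := ((hpp.sub hpq).sub hpi).add hqi
  have heq : ∫ u, p u * Real.log (p u) ∂μ - ∫ u, p u * Real.log (q u) ∂μ =
      ∫ u, (p u * Real.log (p u) - p u * Real.log (q u) - p u + q u) ∂μ := by
    have e₁ : ∫ u, (p u * Real.log (p u) - p u * Real.log (q u) - p u + q u) ∂μ = _ :=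
      integral_add' ((hpp.sub hpq).sub hpi) hqi
    have e₂ : ∫ u, (p u * Real.log (p u) - p u * Real.log (q u) - p u) ∂μ = _ :=
      integral_sub' (hpp.sub hpq) hpi
    have e₃ : ∫ u, (p u * Real.log (p u) - p u * Real.log (q u)) ∂μ = _ :=
      integral_sub' hpp hpq
    linarith
  rw [heq]
  have hnn : ∀ u, 0 ≤ p u * Real.log (p u) - p u * Real.log (q u) - p u + q u :=
    fun u => (relEntropy_integrand_nonneg (hp0 u) (hq0 u)).1
  refine ⟨integral_nonneg hnn, fun h0 => ?_⟩
  rw [integral_eq_zero_iff_of_nonneg hnn hint] at h0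
  filter_upwards [h0] with u hu
  exact (relEntropy_integrand_nonneg (hp0 u) (hq0 u)).2 hu

end Gibbs

/-! ### Joint laws of state and control. -/

section JointLaw

variable {n m : ℕ}

/-- A jointly measurable conditional probability density. -/
structure IsCondDensity (p : EuclideanSpace ℝ (Fin n) → EuclideanSpace ℝ (Fin m) → ℝ) : Prop where
  measurable : Measurable (Function.uncurry p)
  nonneg : ∀ x u, 0 ≤ p x u
  lintegral_eq_one : ∀ x, ∫⁻ u, ENNReal.ofReal (p x u) = 1

variable {ν : Measure (EuclideanSpace ℝ (Fin n))}
  {p : EuclideanSpace ℝ (Fin n) → EuclideanSpace ℝ (Fin m) → ℝ}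

lemma IsCondDensity.measurable_ofReal (hp : IsCondDensity p) :
    Measurable fun z : EuclideanSpace ℝ (Fin n) × EuclideanSpace ℝ (Fin m) =>
      ENNReal.ofReal (p z.1 z.2) :=
  hp.measurable.ennreal_ofReal

lemma jointLaw_apply [SFinite ν] (hp : IsCondDensity p)
    {s : Set (EuclideanSpace ℝ (Fin n) × EuclideanSpace ℝ (Fin m))} (hs : MeasurableSet s) :
    jointLaw ν p s = ∫⁻ x, (volume.withDensity fun u => ENNReal.ofReal (p x u))
      (Prod.mk x ⁻¹' s) ∂ν := by
  rw [jointLaw, withDensity_apply _ hs, ← lintegral_indicator hs,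
    lintegral_prod _ (hp.measurable_ofReal.indicator hs).aemeasurable]
  refine lintegral_congr fun x => ?_
  rw [withDensity_apply _ (measurable_prodMk_left hs),
    ← lintegral_indicator (measurable_prodMk_left hs)]
  rfl

lemma jointLaw_map_fst [SFinite ν] (hp : IsCondDensity p) :
    (jointLaw ν p).map Prod.fst = ν := by
  ext s hs
  rw [Measure.map_apply measurable_fst hs, jointLaw_apply hp (measurable_fst hs),
    ← lintegral_indicator_one hs]
  refine lintegral_congr fun x => ?_
  by_cases hx : x ∈ s
  · have : (Prod.mk x ⁻¹' (Prod.fst ⁻¹' s) : Set (EuclideanSpace ℝ (Fin m))) = Set.univ := by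
      ext u; simp [hx]
    rw [this, withDensity_apply _ MeasurableSet.univ, Measure.restrict_univ,
      hp.lintegral_eq_one]
    simp [hx]
  · have : (Prod.mk x ⁻¹' (Prod.fst ⁻¹' s) : Set (EuclideanSpace ℝ (Fin m))) = ∅ := by
      ext u; simp [hx]
    rw [this]
    simp [hx]

lemma isProbabilityMeasure_jointLaw [IsProbabilityMeasure ν] (hp : IsCondDensity p) :
    IsProbabilityMeasure (jointLaw ν p) := by
  have h := jointLaw_map_fst (ν := ν) hp
  have : IsProbabilityMeasure ((jointLaw ν p).map Prod.fst) := by rw [h]; infer_instance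
  exact Measure.isProbabilityMeasure_of_map Prod.fst

lemma integral_fst_jointLaw [SFinite ν] (hp : IsCondDensity p)
    {f : EuclideanSpace ℝ (Fin n) → ℝ} (hf : AEStronglyMeasurable f ν) :
    ∫ z, f z.1 ∂(jointLaw ν p) = ∫ x, f x ∂ν := by
  have h := jointLaw_map_fst (ν := ν) hp
  conv_rhs => rw [← h]
  rw [integral_map measurable_fst.aemeasurable (by rwa [h])]

lemma integrable_fst_jointLaw [SFinite ν] (hp : IsCondDensity p)
    {f : EuclideanSpace ℝ (Fin n) → ℝ} (hf : Integrable f ν) :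
    Integrable (fun z => f z.1) (jointLaw ν p) := by
  rw [← jointLaw_map_fst (ν := ν) hp] at hf
  exact hf.comp_measurable measurable_fst

/-- Fubini, once the density is moved into the integrand. The almost-everywhere conclusion supplies
the fibrewise integrability that Gibbs' inequality requires. -/
lemma disintegrate_jointLaw [SFinite ν] (hp : IsCondDensity p)
    {f : EuclideanSpace ℝ (Fin n) → EuclideanSpace ℝ (Fin m) → ℝ}
    (hf : Integrable (fun z => f z.1 z.2) (jointLaw ν p)) :
    Integrable (fun x => ∫ u, p x u * f x u) ν ∧
      (∀ᵐ x ∂ν, Integrable (fun u => p x u * f x u) volume) ∧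
      ∫ z, f z.1 z.2 ∂(jointLaw ν p) = ∫ x, (∫ u, p x u * f x u) ∂ν := by
  have hlt : ∀ᵐ z ∂(ν.prod (volume : Measure (EuclideanSpace ℝ (Fin m)))),
    ENNReal.ofReal (p z.1 z.2) < ⊤ := by simp
  have htr : ∀ z : EuclideanSpace ℝ (Fin n) × EuclideanSpace ℝ (Fin m),
      (ENNReal.ofReal (p z.1 z.2)).toReal • f z.1 z.2 = p z.1 z.2 * f z.1 z.2 := fun z => by
    rw [ENNReal.toReal_ofReal (hp.nonneg _ _), smul_eq_mul]
  rw [jointLaw, integrable_withDensity_iff_integrable_smul' hp.measurable_ofReal hlt] at hf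
  rw [jointLaw, integral_withDensity_eq_integral_toReal_smul hp.measurable_ofReal hlt]
  simp_rw [htr] at hf ⊢
  exact ⟨hf.integral_prod_left, hf.prod_right_ae, integral_prod _ hf⟩

lemma jointLaw_congr [SFinite ν]
    {q : EuclideanSpace ℝ (Fin n) → EuclideanSpace ℝ (Fin m) → ℝ} (hp : IsCondDensity p)
    (hq : IsCondDensity q) (h : ∀ᵐ x ∂ν, p x =ᵐ[volume] q x) : jointLaw ν p = jointLaw ν q := by
  ext s hs
  rw [jointLaw_apply hp hs, jointLaw_apply hq hs]
  refine lintegral_congr_ae ?_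
  filter_upwards [h] with x hx
  have : (volume.withDensity fun u => ENNReal.ofReal (p x u)) =
      volume.withDensity fun u => ENNReal.ofReal (q x u) :=
    withDensity_congr_ae (by filter_upwards [hx] with u hu; rw [hu])
  rw [this]

end JointLaw

/-! ### Linear Gaussian feedback. -/

section GaussianKernel

variable {n m : ℕ}

/-- The linear map of a matrix, as a continuous linear map of Euclidean spaces. -/
noncomputable def matCLM {p q : ℕ} (M : Matrix (Fin p) (Fin q) ℝ) :
    EuclideanSpace ℝ (Fin q) →L[ℝ] EuclideanSpace ℝ (Fin p) :=
  LinearMap.toContinuousLinearMap (Matrix.toEuclideanLin M)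

lemma coe_matCLM {p q : ℕ} (M : Matrix (Fin p) (Fin q) ℝ) :
    ⇑(matCLM M) = ⇑(Matrix.toEuclideanLin M) := rfl

lemma isCondDensity_gaussian (M : Matrix (Fin m) (Fin n) ℝ) {S : Matrix (Fin m) (Fin m) ℝ}
    (hS : S.PosDef) :
    IsCondDensity fun x : EuclideanSpace ℝ (Fin n) =>
      gaussianDensity (Matrix.toEuclideanLin M x) S where
  measurable := (continuous_gaussianDensity
    ((matCLM M).continuous.comp continuous_fst) continuous_snd S).measurable
  nonneg _ u := (gaussianDensity_pos hS _ u).le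
  lintegral_eq_one _ := lintegral_gaussianDensity _ hS

lemma multivariateGaussian_eq_map (μ : EuclideanSpace ℝ (Fin m)) (S : Matrix (Fin m) (Fin m) ℝ) :
    multivariateGaussian μ S = (multivariateGaussian 0 S).map (fun w => μ + w) := by
  rw [multivariateGaussian, multivariateGaussian, Measure.map_map (by fun_prop) (by fun_prop)]
  congr 1
  ext x
  simp

/-- The control is `M x` plus noise independent of `x`. This makes the joint law a linear image of a
product measure. -/
lemma jointLaw_gaussian {ν : Measure (EuclideanSpace ℝ (Fin n))} [SFinite ν]
    (M : Matrix (Fin m) (Fin n) ℝ) {S : Matrix (Fin m) (Fin m) ℝ} (hS : S.PosDef) :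
    jointLaw ν (fun x => gaussianDensity (Matrix.toEuclideanLin M x) S) =
      (ν.prod (multivariateGaussian 0 S)).map fun z => (z.1, matCLM M z.1 + z.2) := by
  have hf : Measurable fun z : EuclideanSpace ℝ (Fin n) × EuclideanSpace ℝ (Fin m) =>
    (z.1, matCLM M z.1 + z.2) := by fun_prop
  ext s hs
  rw [jointLaw_apply (isCondDensity_gaussian M hS) hs, Measure.map_apply hf hs,
    Measure.prod_apply (hf hs)]
  refine lintegral_congr fun x => ?_
  rw [← multivariateGaussian_eq_withDensity _ hS, multivariateGaussian_eq_map,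
    Measure.map_apply (by fun_prop) (measurable_prodMk_left hs)]
  rfl

lemma map_matCLM_multivariateGaussian {p q : ℕ} (M : Matrix (Fin p) (Fin q) ℝ)
    {S : Matrix (Fin q) (Fin q) ℝ} (hS : S.PosSemidef) :
    (multivariateGaussian 0 S).map (matCLM M) = multivariateGaussian 0 (M * S * Mᵀ) := by
  refine Measure.ext_of_charFun ?_
  ext t
  rw [charFun_apply, integral_map (by fun_prop) (by fun_prop)]
  have h : ∀ x, inner ℝ (matCLM M x) t = inner ℝ x (matCLM Mᵀ t) := by
    intro x
    simp only [EuclideanSpace.inner_eq_star_dotProduct, star_trivial, coe_matCLM,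
      ofLp_toEuclideanLin]
    rw [dotProduct_comm, ← dotProduct_transpose_mulVec, dotProduct_comm]
  simp_rw [h]
  rw [← charFun_apply, charFun_multivariateGaussian hS,
    charFun_multivariateGaussian (mul_mul_transpose_posSemidef hS M)]
  simp only [coe_matCLM, ofLp_toEuclideanLin, inner_zero_right]
  rw [← mulVec_mulVec, ← mulVec_mulVec]
  conv_rhs => rw [← transpose_transpose M]
  rw [dotProduct_transpose_mulVec, transpose_transpose]

lemma map_add_multivariateGaussian {S T : Matrix (Fin n) (Fin n) ℝ} (hS : S.PosSemidef)
    (hT : T.PosSemidef) :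
    ((multivariateGaussian 0 S).prod (multivariateGaussian 0 T)).map (fun z => z.1 + z.2) =
      multivariateGaussian 0 (S + T) := by
  refine Measure.ext_of_charFun ?_
  rw [charFun_map_add_prod_eq_mul]
  ext t
  rw [Pi.mul_apply, charFun_multivariateGaussian hS, charFun_multivariateGaussian hT,
    charFun_multivariateGaussian (hS.add hT), ← Complex.exp_add, add_mulVec, dotProduct_add]
  congr 1
  push_cast
  simp
  ring

/-- A linear system with Gaussian state and linear Gaussian feedback. -/
lemma map_jointLaw_gaussian (A : Matrix (Fin n) (Fin n) ℝ) (B : Matrix (Fin n) (Fin m) ℝ)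
    (M : Matrix (Fin m) (Fin n) ℝ) {P : Matrix (Fin n) (Fin n) ℝ} {S : Matrix (Fin m) (Fin m) ℝ}
    (hP : P.PosSemidef) (hS : S.PosDef) :
    (jointLaw (multivariateGaussian 0 P)
        (fun x => gaussianDensity (Matrix.toEuclideanLin M x) S)).map
      (fun z => Matrix.toEuclideanLin A z.1 + Matrix.toEuclideanLin B z.2) =
    multivariateGaussian 0 ((A + B * M) * P * (A + B * M)ᵀ + B * S * Bᵀ) := by
  rw [← map_add_multivariateGaussian (mul_mul_transpose_posSemidef hP _)
    (mul_mul_transpose_posSemidef hS.posSemidef B), ← map_matCLM_multivariateGaussian _ hP,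
    ← map_matCLM_multivariateGaussian _ hS.posSemidef,
    Measure.map_prod_map _ _ (by fun_prop) (by fun_prop), jointLaw_gaussian M hS]
  simp only [← coe_matCLM]
  rw [Measure.map_map (by fun_prop) (by fun_prop), Measure.map_map (by fun_prop) (by fun_prop)]
  congr 1
  ext1 z
  simp only [Function.comp_apply, Prod.map_fst, Prod.map_snd, map_add, coe_matCLM]
  rw [← add_assoc]
  congr 1
  apply WithLp.ofLp_injective 2
  simp

lemma isGaussian_jointLaw {P : Matrix (Fin n) (Fin n) ℝ}
    (M : Matrix (Fin m) (Fin n) ℝ) {S : Matrix (Fin m) (Fin m) ℝ} (hS : S.PosDef) :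
    IsGaussian (jointLaw (multivariateGaussian 0 P)
      (fun x => gaussianDensity (Matrix.toEuclideanLin M x) S)) := by
  rw [jointLaw_gaussian M hS]
  exact isGaussian_map (μ := (multivariateGaussian 0 P).prod (multivariateGaussian 0 S))
    ((ContinuousLinearMap.fst ℝ (EuclideanSpace ℝ (Fin n)) (EuclideanSpace ℝ (Fin m))).prod
      ((matCLM M).comp (ContinuousLinearMap.fst ℝ _ _) + ContinuousLinearMap.snd ℝ _ _))

end GaussianKernel

/-! ### The stage cost as a relative entropy. -/

section Stage

variable {n m : ℕ}

lemma memLp_matCLM {Ω : Type*} [MeasurableSpace Ω] {P : Measure Ω} {p q : ℕ}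
    (M : Matrix (Fin p) (Fin q) ℝ) {X : Ω → EuclideanSpace ℝ (Fin q)} (hX : MemLp X 2 P) :
    MemLp (fun ω => Matrix.toEuclideanLin M (X ω)) 2 P :=
  (matCLM M).comp_memLp' hX

lemma integrable_quadraticForm {Ω : Type*} [MeasurableSpace Ω] {P : Measure Ω}
    (M : Matrix (Fin n) (Fin n) ℝ) {X : Ω → EuclideanSpace ℝ (Fin n)} (hX : MemLp X 2 P) :
    Integrable (fun ω => (X ω).ofLp ⬝ᵥ M *ᵥ (X ω).ofLp) P := by
  have hcoord : ∀ {Y : Ω → EuclideanSpace ℝ (Fin n)}, MemLp Y 2 P → ∀ i,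
      MemLp (fun ω => (Y ω).ofLp i) 2 P :=
    fun hY i => (EuclideanSpace.proj (𝕜 := ℝ) i).comp_memLp' hY
  simp only [dotProduct]
  refine integrable_finsetSum _ fun i _ => ?_
  exact (hcoord hX i).integrable_mul (hcoord (memLp_matCLM M hX) i)

variable {ν : Measure (EuclideanSpace ℝ (Fin n))}
  {p q : EuclideanSpace ℝ (Fin n) → EuclideanSpace ℝ (Fin m) → ℝ}

lemma memLp_fst_jointLaw [SFinite ν] (hp : IsCondDensity p) (hν : MemLp id 2 ν) :
    MemLp Prod.fst 2 (jointLaw ν p) := by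
  have h := jointLaw_map_fst (ν := ν) hp
  rw [← h] at hν
  exact (memLp_map_measure_iff hν.1 measurable_fst.aemeasurable).1 hν

lemma memLp_snd_jointLaw (henergy : Integrable (fun z => ‖z.2‖ ^ 2) (jointLaw ν p)) :
    MemLp Prod.snd 2 (jointLaw ν p) :=
  (memLp_two_iff_integrable_sq_norm measurable_snd.aestronglyMeasurable).2 henergy

lemma memLp_next {J : Measure (EuclideanSpace ℝ (Fin n) × EuclideanSpace ℝ (Fin m))}
    (A : Matrix (Fin n) (Fin n) ℝ) (B : Matrix (Fin n) (Fin m) ℝ)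
    (h1 : MemLp Prod.fst 2 J) (h2 : MemLp Prod.snd 2 J) :
    MemLp (fun z => Matrix.toEuclideanLin A z.1 + Matrix.toEuclideanLin B z.2) 2 J :=
  (memLp_matCLM A h1).add (memLp_matCLM B h2)

lemma measurable_next (A : Matrix (Fin n) (Fin n) ℝ) (B : Matrix (Fin n) (Fin m) ℝ) :
    Measurable fun z : EuclideanSpace ℝ (Fin n) × EuclideanSpace ℝ (Fin m) =>
      Matrix.toEuclideanLin A z.1 + Matrix.toEuclideanLin B z.2 := by
  simp only [← coe_matCLM]
  fun_prop

/-- The relative entropy of `p x` with respect to `q x`. -/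
noncomputable def relEnt (p q : EuclideanSpace ℝ (Fin n) → EuclideanSpace ℝ (Fin m) → ℝ)
    (x : EuclideanSpace ℝ (Fin n)) : ℝ :=
  -entropy (p x) - ∫ u, p x u * Real.log (q x u)

lemma relEnt_self (x : EuclideanSpace ℝ (Fin n)) : relEnt p p x = 0 := by
  simp [relEnt, entropy]

lemma integrable_relEnt [SFinite ν] (hp : IsCondDensity p)
    (hlog : Integrable (fun z => Real.log (q z.1 z.2)) (jointLaw ν p))
    (hent : Integrable (fun x => entropy (p x)) ν) :
    Integrable (relEnt p q) ν ∧ ∫ x, relEnt p q x ∂ν =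
      -∫ x, entropy (p x) ∂ν - ∫ z, Real.log (q z.1 z.2) ∂(jointLaw ν p) := by
  obtain ⟨h1, -, h3⟩ := disintegrate_jointLaw (f := fun x u => Real.log (q x u)) hp hlog
  refine ⟨hent.neg.sub h1, ?_⟩
  rw [h3, ← integral_neg]
  exact integral_sub hent.neg h1

lemma relEnt_nonneg_ae [SFinite ν] (hp : IsCondDensity p) (hq : IsCondDensity q)
    (hq0 : ∀ x u, 0 < q x u)
    (hlog : Integrable (fun z => Real.log (q z.1 z.2)) (jointLaw ν p))
    (hent : ∀ᵐ x ∂ν, Integrable (fun u => p x u * Real.log (p x u)) volume) :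
    ∀ᵐ x ∂ν, 0 ≤ relEnt p q x ∧ (relEnt p q x = 0 → p x =ᵐ[volume] q x) := by
  obtain ⟨-, h2, -⟩ := disintegrate_jointLaw (f := fun x u => Real.log (q x u)) hp hlog
  filter_upwards [hent, h2] with x hx1 hx2
  have := gibbs (hp.measurable.of_uncurry_left) (hq.measurable.of_uncurry_left)
    (hp.nonneg x) (hq0 x) (hp.lintegral_eq_one x) (hq.lintegral_eq_one x) hx1 hx2
  simpa only [relEnt, entropy, neg_neg] using this

variable {ε : ℝ} {Γ : Matrix (Fin m) (Fin m) ℝ} (M : Matrix (Fin m) (Fin n) ℝ)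

/-- The logarithm of the normalizing constant of the Gaussian density of covariance `S`. -/
noncomputable def logNorm (S : Matrix (Fin m) (Fin m) ℝ) : ℝ :=
  Real.log (Real.sqrt ((2 * Real.pi) ^ m * S.det))

lemma log_gaussianKernel (hε : 0 < ε) (hΓ : Γ.PosDef) (x : EuclideanSpace ℝ (Fin n))
    (u : EuclideanSpace ℝ (Fin m)) :
    Real.log (gaussianDensity (Matrix.toEuclideanLin M x) (ε • Γ⁻¹) u) =
      -logNorm (ε • Γ⁻¹) - 1 / (2 * ε) * ((u - Matrix.toEuclideanLin M x).ofLp ⬝ᵥ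
        Γ *ᵥ (u - Matrix.toEuclideanLin M x).ofLp) := by
  have hinv : (ε • Γ⁻¹)⁻¹ = ε⁻¹ • Γ := by
    refine inv_eq_left_inv ?_
    rw [Matrix.smul_mul, Matrix.mul_smul, mul_inv_of_isUnit hΓ.isUnit, smul_smul,
      inv_mul_cancel₀ hε.ne', one_smul]
  rw [log_gaussianDensity (hΓ.inv.smul hε), hinv, smul_mulVec, dotProduct_smul, logNorm,
    smul_eq_mul]
  field_simp

/-- The logarithm is a quadratic polynomial in state and control, so second moments suffice. `J` may
thus be the joint law of any competitor of finite energy. -/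
lemma integrable_log_gaussianKernel (hε : 0 < ε) (hΓ : Γ.PosDef)
    {J : Measure (EuclideanSpace ℝ (Fin n) × EuclideanSpace ℝ (Fin m))} [IsFiniteMeasure J]
    (h1 : MemLp Prod.fst 2 J) (h2 : MemLp Prod.snd 2 J) :
    Integrable (fun z => Real.log (gaussianDensity (Matrix.toEuclideanLin M z.1)
      (ε • Γ⁻¹) z.2)) J := by
  simp_rw [log_gaussianKernel M hε hΓ]
  exact (integrable_const _).sub
    ((integrable_quadraticForm Γ (h2.sub (memLp_matCLM M h1))).const_mul _)

lemma integral_linear_combination {Ω : Type*} [MeasurableSpace Ω] {P : Measure Ω}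
    [IsProbabilityMeasure P] {f g h k : Ω → ℝ} (hf : Integrable f P) (hg : Integrable g P)
    (hh : Integrable h P) (hk : Integrable k P) (a b c ε : ℝ) :
    ∫ ω, (a * f ω - b * g ω - c - ε * h ω - ε * k ω) ∂P =
      a * ∫ ω, f ω ∂P - b * ∫ ω, g ω ∂P - c - ε * ∫ ω, h ω ∂P - ε * ∫ ω, k ω ∂P := by
  have i1 := hf.const_mul a
  have i2 := hg.const_mul b
  have i3 : Integrable (fun _ => c) P := integrable_const _
  have i4 := hh.const_mul ε
  have i5 := hk.const_mul ε
  have e₁ : ∫ ω, (a * f ω - b * g ω - c - ε * h ω - ε * k ω) ∂P = _ :=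
    integral_sub' (((i1.sub i2).sub i3).sub i4) i5
  have e₂ : ∫ ω, (a * f ω - b * g ω - c - ε * h ω) ∂P = _ :=
    integral_sub' ((i1.sub i2).sub i3) i4
  have e₃ : ∫ ω, (a * f ω - b * g ω - c) ∂P = _ := integral_sub' (i1.sub i2) i3
  have e₄ : ∫ ω, (a * f ω - b * g ω) ∂P = _ := integral_sub' i1 i2
  simp only [integral_const_mul, integral_const, probReal_univ, one_smul] at e₁ e₂ e₃ e₄
  linarith

/-- One step of dynamic programming. -/
lemma stage_identity [IsProbabilityMeasure ν] (hε : 0 < ε) (hΓ : Γ.PosDef)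
    (hp : IsCondDensity p) (hν : MemLp id 2 ν)
    (henergy : Integrable (fun z => ‖z.2‖ ^ 2) (jointLaw ν p))
    (hent : Integrable (fun x => entropy (p x)) ν)
    {A R R' : Matrix (Fin n) (Fin n) ℝ} {B : Matrix (Fin n) (Fin m) ℝ}
    (hsq : ∀ (x : Fin n → ℝ) (u : Fin m → ℝ),
      u ⬝ᵥ u + (A *ᵥ x + B *ᵥ u) ⬝ᵥ R' *ᵥ (A *ᵥ x + B *ᵥ u) =
        (u - M *ᵥ x) ⬝ᵥ Γ *ᵥ (u - M *ᵥ x) + x ⬝ᵥ R *ᵥ x) :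
    ∫ z, (1 / 2 * ‖z.2‖ ^ 2 - ε * entropy (p z.1)) ∂(jointLaw ν p) =
      1 / 2 * ∫ x, x.ofLp ⬝ᵥ R *ᵥ x.ofLp ∂ν -
      1 / 2 * ∫ x, x.ofLp ⬝ᵥ R' *ᵥ x.ofLp ∂((jointLaw ν p).map
        fun z => Matrix.toEuclideanLin A z.1 + Matrix.toEuclideanLin B z.2) -
      ε * logNorm (ε • Γ⁻¹) +
      ε * ∫ x, relEnt p (fun x => gaussianDensity (Matrix.toEuclideanLin M x) (ε • Γ⁻¹)) x ∂ν := by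
  have := isProbabilityMeasure_jointLaw (ν := ν) hp
  have h1 := memLp_fst_jointLaw hp hν
  have h2 := memLp_snd_jointLaw henergy
  have hlog := integrable_log_gaussianKernel M hε hΓ h1 h2
  have hqx : Integrable (fun x : EuclideanSpace ℝ (Fin n) => x.ofLp ⬝ᵥ R *ᵥ x.ofLp) ν :=
    integrable_quadraticForm R hν
  have hqx' := integrable_fst_jointLaw hp hqx
  have hqn := integrable_quadraticForm R' (memLp_next A B h1 h2)
  have hent' := integrable_fst_jointLaw hp hent
  have hnext : ∫ x, x.ofLp ⬝ᵥ R' *ᵥ x.ofLp ∂((jointLaw ν p).map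
      fun z => Matrix.toEuclideanLin A z.1 + Matrix.toEuclideanLin B z.2) = _ :=
    integral_map (measurable_next A B).aemeasurable (by
      refine Continuous.aestronglyMeasurable ?_
      have h : Continuous fun x : EuclideanSpace ℝ (Fin n) => x.ofLp := PiLp.continuous_ofLp 2 _
      exact h.dotProduct (continuous_const.matrix_mulVec h))
  have hrel := (integrable_relEnt
    (q := fun x => gaussianDensity (Matrix.toEuclideanLin M x) (ε • Γ⁻¹)) hp hlog hent).2
  have e₁ := integral_fst_jointLaw hp hqx.1
  have e₂ := integral_fst_jointLaw hp hent.1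
  rw [hrel, hnext, ← e₁, ← e₂]
  -- The completed square `½ (u - M x)ᵀ Γ (u - M x)` equals `-ε log q - ε logNorm`, where `q` is the
  -- Gaussian kernel of covariance `ε Γ⁻¹`.
  have hpt : ∀ z : EuclideanSpace ℝ (Fin n) × EuclideanSpace ℝ (Fin m),
      1 / 2 * ‖z.2‖ ^ 2 - ε * entropy (p z.1) =
      1 / 2 * (z.1.ofLp ⬝ᵥ R *ᵥ z.1.ofLp) -
      1 / 2 * ((Matrix.toEuclideanLin A z.1 + Matrix.toEuclideanLin B z.2).ofLp ⬝ᵥ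
        R' *ᵥ (Matrix.toEuclideanLin A z.1 + Matrix.toEuclideanLin B z.2).ofLp) -
      ε * logNorm (ε • Γ⁻¹) - ε * Real.log (gaussianDensity (Matrix.toEuclideanLin M z.1)
        (ε • Γ⁻¹) z.2) - ε * entropy (p z.1) := by
    intro z
    have h := hsq z.1.ofLp z.2.ofLp
    rw [dotProduct_self_eq_norm_sq] at h
    rw [log_gaussianKernel M hε hΓ, WithLp.ofLp_add, WithLp.ofLp_sub]
    simp only [ofLp_toEuclideanLin]
    have h3 : ‖z.2‖ ^ 2 = (z.2.ofLp - M *ᵥ z.1.ofLp) ⬝ᵥ Γ *ᵥ (z.2.ofLp - M *ᵥ z.1.ofLp) +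
      z.1.ofLp ⬝ᵥ R *ᵥ z.1.ofLp - (A *ᵥ z.1.ofLp + B *ᵥ z.2.ofLp) ⬝ᵥ
        R' *ᵥ (A *ᵥ z.1.ofLp + B *ᵥ z.2.ofLp) := by linarith
    rw [h3]
    field_simp
    ring
  rw [integral_congr_ae (Filter.Eventually.of_forall hpt)]
  rw [integral_linear_combination hqx' hqn hlog hent' (1 / 2) (1 / 2)
    (ε * logNorm (ε • Γ⁻¹)) ε]
  ring

end Stage

/-! ### Verification: feasibility, optimality and uniqueness. -/

section Verification

variable {n m : ℕ} {A : ℕ → Matrix (Fin n) (Fin n) ℝ} {B : ℕ → Matrix (Fin n) (Fin m) ℝ}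
  {N : ℕ} {ε : ℝ} {Sig₀ SigN : Matrix (Fin n) (Fin n) ℝ}
  {ν : Measure (EuclideanSpace ℝ (Fin n))}
  {π : ℕ → EuclideanSpace ℝ (Fin n) → EuclideanSpace ℝ (Fin m) → ℝ}

lemma IsPolicy.isCondDensity (h : IsPolicy N π) {k : ℕ} (hk : k < N) : IsCondDensity (π k) :=
  ⟨h.measurable k hk, h.nonneg k hk, h.lintegral_eq_one k hk⟩

lemma isProbabilityMeasure_stateLaw [IsProbabilityMeasure ν] (h : IsPolicy N π) :
    ∀ k ≤ N, IsProbabilityMeasure (stateLaw A B ν π k)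
  | 0, _ => by rw [stateLaw]; infer_instance
  | k + 1, hk => by
    have := isProbabilityMeasure_stateLaw h k (by lia)
    have := isProbabilityMeasure_jointLaw (ν := stateLaw A B ν π k) (h.isCondDensity hk)
    exact Measure.isProbabilityMeasure_map (measurable_next _ _).aemeasurable

/-- Finite control energy propagates second moments through the linear dynamics, so all value
functions are integrable along the competitor. -/
lemma memLp_stateLaw [IsProbabilityMeasure ν] (hν : MemLp id 2 ν) (h : IsPolicy N π)
    (hc : HasFiniteCost A B N ν π) : ∀ k ≤ N, MemLp id 2 (stateLaw A B ν π k)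
  | 0, _ => hν
  | k + 1, hk => by
    have := isProbabilityMeasure_stateLaw (A := A) (B := B) (ν := ν) h k (by lia)
    have h1 := memLp_fst_jointLaw (h.isCondDensity hk) (memLp_stateLaw hν h hc k (by lia))
    have h2 := memLp_snd_jointLaw (hc.energy k hk)
    exact (memLp_map_measure_iff aestronglyMeasurable_id
      (measurable_next (A k) (B k)).aemeasurable).2 (memLp_next (A k) (B k) h1 h2)

lemma optPolicy_eq (k : ℕ) : optPolicy A B N ε Sig₀ SigN k = fun x =>
    gaussianDensity (Matrix.toEuclideanLin (-optGain A B N ε Sig₀ SigN k) x)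
      (ε • (gainMatrix A B N ε Sig₀ SigN k)⁻¹) := by
  funext x
  rw [map_neg]
  rfl

lemma isCondDensity_optPolicy (hε : 0 < ε) {k : ℕ}
    (hΓ : (gainMatrix A B N ε Sig₀ SigN k).PosDef) :
    IsCondDensity (optPolicy A B N ε Sig₀ SigN k) := by
  rw [optPolicy_eq]
  exact isCondDensity_gaussian _ (hΓ.inv.smul hε)

lemma isPolicy_optPolicy (hε : 0 < ε)
    (hΓ : ∀ k < N, (gainMatrix A B N ε Sig₀ SigN k).PosDef) :
    IsPolicy N (optPolicy A B N ε Sig₀ SigN) :=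
  ⟨fun k hk => (isCondDensity_optPolicy hε (hΓ k hk)).measurable,
    fun k hk => (isCondDensity_optPolicy hε (hΓ k hk)).nonneg,
    fun k hk => (isCondDensity_optPolicy hε (hΓ k hk)).lintegral_eq_one⟩

lemma optPolicy_pos (hε : 0 < ε) {k : ℕ} (hΓ : (gainMatrix A B N ε Sig₀ SigN k).PosDef)
    (x : EuclideanSpace ℝ (Fin n)) (u : EuclideanSpace ℝ (Fin m)) :
    0 < optPolicy A B N ε Sig₀ SigN k x u := by
  rw [optPolicy_eq]
  exact gaussianDensity_pos (hΓ.inv.smul hε) _ _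

lemma stateLaw_optPolicy (hε : 0 < ε) (hA : ∀ k < N, IsUnit (A k))
    (hG : (ctrlGramian A B N 0).PosDef) (h₀ : Sig₀.PosDef) (h₁ : SigN.PosDef)
    (hF : IsUnit (calF (scaledInit A B N ε Sig₀) (scaledFinal A B N ε SigN))) :
    ∀ k ≤ N, stateLaw A B (multivariateGaussian 0 Sig₀) (optPolicy A B N ε Sig₀ SigN) k =
      multivariateGaussian 0 (optCov A B N ε Sig₀ SigN k)
  | 0, hk => by
    rw [stateLaw, optCov_zero hε (Qminus_isUnit hε hA hG h₀ h₁ hF hk)]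
  | k + 1, hk => by
    have hΓ := gainMatrix_posDef hε hA hG h₀ h₁ hF (k := k) hk
    rw [stateLaw, stateLaw_optPolicy hε hA hG h₀ h₁ hF k (by lia), optPolicy_eq,
      map_jointLaw_gaussian _ _ _ (optCov_posDef hε hA hG h₀ h₁ hF k (by lia)).posSemidef
        (hΓ.inv.smul hε), optCov_succ hε hA hG h₀ h₁ hF hk, Matrix.mul_neg, ← sub_eq_add_neg]

lemma isFeasible_optPolicy (hε : 0 < ε) (hA : ∀ k < N, IsUnit (A k))
    (hG : (ctrlGramian A B N 0).PosDef) (h₀ : Sig₀.PosDef) (h₁ : SigN.PosDef)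
    (hF : IsUnit (calF (scaledInit A B N ε Sig₀) (scaledFinal A B N ε SigN))) :
    IsFeasible A B N Sig₀ SigN (optPolicy A B N ε Sig₀ SigN) where
  policy := isPolicy_optPolicy hε fun _ hk => gainMatrix_posDef hε hA hG h₀ h₁ hF hk
  final := by
    rw [stateLaw_optPolicy hε hA hG h₀ h₁ hF N le_rfl, optCov_final hε hA hG h₀ h₁ hF]

lemma integrable_log_optPolicy (hε : 0 < ε) {k : ℕ}
    (hΓ : (gainMatrix A B N ε Sig₀ SigN k).PosDef)
    {J : Measure (EuclideanSpace ℝ (Fin n) × EuclideanSpace ℝ (Fin m))} [IsFiniteMeasure J]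
    (h1 : MemLp Prod.fst 2 J) (h2 : MemLp Prod.snd 2 J) :
    Integrable (fun z => Real.log (optPolicy A B N ε Sig₀ SigN k z.1 z.2)) J := by
  rw [optPolicy_eq]
  exact integrable_log_gaussianKernel _ hε hΓ h1 h2

/-- State and control are jointly Gaussian, hence square integrable. Disintegrating the policy's own
log-density then yields both entropy conditions. -/
lemma hasFiniteCost_optPolicy (hε : 0 < ε) (hA : ∀ k < N, IsUnit (A k))
    (hG : (ctrlGramian A B N 0).PosDef) (h₀ : Sig₀.PosDef) (h₁ : SigN.PosDef)
    (hF : IsUnit (calF (scaledInit A B N ε Sig₀) (scaledFinal A B N ε SigN))) :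
    HasFiniteCost A B N (multivariateGaussian 0 Sig₀) (optPolicy A B N ε Sig₀ SigN) := by
  have hJ : ∀ k < N, IsGaussian (stageLaw A B (multivariateGaussian 0 Sig₀)
      (optPolicy A B N ε Sig₀ SigN) k) := fun k hk => by
    have hΓ := gainMatrix_posDef hε hA hG h₀ h₁ hF hk
    rw [stageLaw, stateLaw_optPolicy hε hA hG h₀ h₁ hF k hk.le, optPolicy_eq]
    exact isGaussian_jointLaw _ (hΓ.inv.smul hε)
  have hfst : ∀ k < N, MemLp Prod.fst 2 (stageLaw A B (multivariateGaussian 0 Sig₀)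
      (optPolicy A B N ε Sig₀ SigN) k) := fun k hk => by
    have := hJ k hk
    exact (ContinuousLinearMap.fst ℝ (EuclideanSpace ℝ (Fin n))
      (EuclideanSpace ℝ (Fin m))).comp_memLp' IsGaussian.memLp_two_id
  have hsnd : ∀ k < N, MemLp Prod.snd 2 (stageLaw A B (multivariateGaussian 0 Sig₀)
      (optPolicy A B N ε Sig₀ SigN) k) := fun k hk => by
    have := hJ k hk
    exact (ContinuousLinearMap.snd ℝ (EuclideanSpace ℝ (Fin n))
      (EuclideanSpace ℝ (Fin m))).comp_memLp' IsGaussian.memLp_two_id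
  have hdis := fun k (hk : k < N) => by
    have hΓ := gainMatrix_posDef hε hA hG h₀ h₁ hF hk
    have := isProbabilityMeasure_stateLaw (A := A) (B := B) (ν := multivariateGaussian 0 Sig₀)
      (isFeasible_optPolicy hε hA hG h₀ h₁ hF).policy k hk.le
    have := isProbabilityMeasure_jointLaw (ν := stateLaw A B (multivariateGaussian 0 Sig₀)
      (optPolicy A B N ε Sig₀ SigN) k) (isCondDensity_optPolicy hε hΓ)
    exact disintegrate_jointLaw
      (f := fun x u => Real.log (optPolicy A B N ε Sig₀ SigN k x u))
      (isCondDensity_optPolicy hε hΓ) (integrable_log_optPolicy hε hΓ (hfst k hk) (hsnd k hk))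
  exact
    { energy := fun k hk =>
        (memLp_two_iff_integrable_sq_norm measurable_snd.aestronglyMeasurable).1 (hsnd k hk)
      entropy_ae := fun k hk => (hdis k hk).2.1
      entropy_int := fun k hk => (hdis k hk).1.neg }

lemma integrable_log_optPolicy_stageLaw [IsProbabilityMeasure ν] (hε : 0 < ε)
    (hν : MemLp id 2 ν) (h : IsPolicy N π) (hc : HasFiniteCost A B N ν π) {k : ℕ} (hk : k < N)
    (hΓ : (gainMatrix A B N ε Sig₀ SigN k).PosDef) :
    Integrable (fun z => Real.log (optPolicy A B N ε Sig₀ SigN k z.1 z.2))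
      (jointLaw (stateLaw A B ν π k) (π k)) := by
  have := isProbabilityMeasure_stateLaw (A := A) (B := B) (ν := ν) h k hk.le
  have := isProbabilityMeasure_jointLaw (ν := stateLaw A B ν π k) (h.isCondDensity hk)
  exact integrable_log_optPolicy hε hΓ
    (memLp_fst_jointLaw (h.isCondDensity hk) (memLp_stateLaw hν h hc k hk.le))
    (memLp_snd_jointLaw (hc.energy k hk))

lemma relEnt_optPolicy [IsProbabilityMeasure ν] (hε : 0 < ε)
    (hν : MemLp id 2 ν) (h : IsPolicy N π) (hc : HasFiniteCost A B N ν π) {k : ℕ} (hk : k < N)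
    (hΓ : (gainMatrix A B N ε Sig₀ SigN k).PosDef) :
    0 ≤ ∫ x, relEnt (π k) (optPolicy A B N ε Sig₀ SigN k) x ∂(stateLaw A B ν π k) ∧
    (∫ x, relEnt (π k) (optPolicy A B N ε Sig₀ SigN k) x ∂(stateLaw A B ν π k) = 0 →
      ∀ᵐ x ∂(stateLaw A B ν π k),
        π k x =ᵐ[volume] optPolicy A B N ε Sig₀ SigN k x) := by
  have := isProbabilityMeasure_stateLaw (A := A) (B := B) (ν := ν) h k hk.le
  have hlog := integrable_log_optPolicy_stageLaw hε hν h hc hk hΓ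
  have hnn := relEnt_nonneg_ae (h.isCondDensity hk) (isCondDensity_optPolicy hε hΓ)
    (optPolicy_pos hε hΓ) hlog (hc.entropy_ae k hk)
  have hnn' : 0 ≤ᵐ[stateLaw A B ν π k] relEnt (π k) (optPolicy A B N ε Sig₀ SigN k) := by
    filter_upwards [hnn] with x hx
    exact hx.1
  refine ⟨integral_nonneg_of_ae hnn', fun h0 => ?_⟩
  rw [integral_eq_zero_iff_of_nonneg_ae hnn'
    (integrable_relEnt (h.isCondDensity hk) hlog (hc.entropy_int k hk)).1] at h0
  filter_upwards [hnn, h0] with x hx hx0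
  exact hx.2 hx0

/-- The mean of the quadratic value function at stage `k`. -/
noncomputable def meanValue (A : ℕ → Matrix (Fin n) (Fin n) ℝ)
    (B : ℕ → Matrix (Fin n) (Fin m) ℝ) (N : ℕ) (ε : ℝ) (Sig₀ SigN : Matrix (Fin n) (Fin n) ℝ)
    (k : ℕ) (ν : Measure (EuclideanSpace ℝ (Fin n))) : ℝ :=
  1 / 2 * ∫ x, x.ofLp ⬝ᵥ (Qminus A B N ε Sig₀ SigN k)⁻¹ *ᵥ x.ofLp ∂ν

lemma stage_cost_eq (hε : 0 < ε) (hA : ∀ k < N, IsUnit (A k))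
    (hG : (ctrlGramian A B N 0).PosDef) (h₀ : Sig₀.PosDef) (h₁ : SigN.PosDef)
    (hF : IsUnit (calF (scaledInit A B N ε Sig₀) (scaledFinal A B N ε SigN)))
    [IsProbabilityMeasure ν] (hν : MemLp id 2 ν) (h : IsPolicy N π)
    (hc : HasFiniteCost A B N ν π) {k : ℕ} (hk : k < N) :
    ∫ z, (1 / 2 * ‖z.2‖ ^ 2 - ε * entropy (π k z.1)) ∂(stageLaw A B ν π k) =
      meanValue A B N ε Sig₀ SigN k (stateLaw A B ν π k) -
      meanValue A B N ε Sig₀ SigN (k + 1) (stateLaw A B ν π (k + 1)) -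
      ε * logNorm (ε • (gainMatrix A B N ε Sig₀ SigN k)⁻¹) +
      ε * ∫ x, relEnt (π k) (optPolicy A B N ε Sig₀ SigN k) x ∂(stateLaw A B ν π k) := by
  have := isProbabilityMeasure_stateLaw (A := A) (B := B) (ν := ν) h k hk.le
  have hΓ := gainMatrix_posDef hε hA hG h₀ h₁ hF hk
  rw [optPolicy_eq]
  refine stage_identity (-optGain A B N ε Sig₀ SigN k) hε hΓ (h.isCondDensity hk)
    (memLp_stateLaw hν h hc k hk.le) (hc.energy k hk) (hc.entropy_int k hk) fun x u => ?_
  rw [neg_mulVec, sub_neg_eq_add]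
  exact complete_square (hA k hk) (Qminus_isUnit hε hA hG h₀ h₁ hF hk)
    (Qminus_transpose hε hG h₀ (k + 1)) hΓ.isUnit rfl x u

/-- The finite cost of a feasible policy, as its relative entropy with respect to the optimal
policy plus a constant. -/
lemma total_cost_eq (hε : 0 < ε) (hA : ∀ k < N, IsUnit (A k))
    (hG : (ctrlGramian A B N 0).PosDef) (h₀ : Sig₀.PosDef) (h₁ : SigN.PosDef)
    (hF : IsUnit (calF (scaledInit A B N ε Sig₀) (scaledFinal A B N ε SigN)))
    (h : IsFeasible A B N Sig₀ SigN π)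
    (hc : HasFiniteCost A B N (multivariateGaussian 0 Sig₀) π) :
    ∑ k ∈ Finset.range N, ∫ z, (1 / 2 * ‖z.2‖ ^ 2 - ε * entropy (π k z.1))
        ∂(stageLaw A B (multivariateGaussian 0 Sig₀) π k) =
      meanValue A B N ε Sig₀ SigN 0 (multivariateGaussian 0 Sig₀) -
      meanValue A B N ε Sig₀ SigN N (multivariateGaussian 0 SigN) -
      ∑ k ∈ Finset.range N, ε * logNorm (ε • (gainMatrix A B N ε Sig₀ SigN k)⁻¹) +
      ε * ∑ k ∈ Finset.range N, ∫ x, relEnt (π k) (optPolicy A B N ε Sig₀ SigN k) x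
        ∂(stateLaw A B (multivariateGaussian 0 Sig₀) π k) := by
  -- The mean values telescope; `h.final` replaces the last state law by the prescribed one, so the
  -- boundary terms no longer depend on the policy.
  rw [Finset.sum_congr rfl fun k hk => stage_cost_eq hε hA hG h₀ h₁ hF IsGaussian.memLp_two_id
    h.policy hc (Finset.mem_range.1 hk), Finset.sum_add_distrib, Finset.sum_sub_distrib,
    Finset.sum_range_sub' (fun k => meanValue A B N ε Sig₀ SigN k
      (stateLaw A B (multivariateGaussian 0 Sig₀) π k)), h.final, Finset.mul_sum]
  rfl

lemma isOptimal_optPolicy (hε : 0 < ε) (hA : ∀ k < N, IsUnit (A k))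
    (hG : (ctrlGramian A B N 0).PosDef) (h₀ : Sig₀.PosDef) (h₁ : SigN.PosDef)
    (hF : IsUnit (calF (scaledInit A B N ε Sig₀) (scaledFinal A B N ε SigN))) :
    IsOptimal A B N ε Sig₀ SigN (optPolicy A B N ε Sig₀ SigN) where
  feasible := isFeasible_optPolicy hε hA hG h₀ h₁ hF
  minimal ρ hρ := by
    by_cases hc : HasFiniteCost A B N (multivariateGaussian 0 Sig₀) ρ
    · have hc' := hasFiniteCost_optPolicy hε hA hG h₀ h₁ hF
      rw [cost, cost, if_pos hc, if_pos hc', EReal.coe_le_coe_iff,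
        total_cost_eq hε hA hG h₀ h₁ hF (isFeasible_optPolicy hε hA hG h₀ h₁ hF) hc',
        total_cost_eq hε hA hG h₀ h₁ hF hρ hc]
      simp only [relEnt_self, integral_zero, Finset.sum_const_zero, mul_zero, add_zero]
      exact le_add_of_nonneg_right (mul_nonneg hε.le (Finset.sum_nonneg fun k hk =>
        (relEnt_optPolicy hε IsGaussian.memLp_two_id hρ.policy hc (Finset.mem_range.1 hk)
          (gainMatrix_posDef hε hA hG h₀ h₁ hF (Finset.mem_range.1 hk))).1))
    · rw [cost, cost, if_neg hc]
      exact le_top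

lemma cost_optPolicy_lt_top (hε : 0 < ε) (hA : ∀ k < N, IsUnit (A k))
    (hG : (ctrlGramian A B N 0).PosDef) (h₀ : Sig₀.PosDef) (h₁ : SigN.PosDef)
    (hF : IsUnit (calF (scaledInit A B N ε Sig₀) (scaledFinal A B N ε SigN))) :
    cost A B N ε (multivariateGaussian 0 Sig₀) (optPolicy A B N ε Sig₀ SigN) < ⊤ := by
  rw [cost, if_pos (hasFiniteCost_optPolicy hε hA hG h₀ h₁ hF)]
  exact EReal.coe_lt_top _

/-- An optimal policy agrees with the Gaussian one at almost every state visited. -/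
lemma IsOptimal.ae_stateLaw_eq (hε : 0 < ε) (hA : ∀ k < N, IsUnit (A k))
    (hG : (ctrlGramian A B N 0).PosDef) (h₀ : Sig₀.PosDef) (h₁ : SigN.PosDef)
    (hF : IsUnit (calF (scaledInit A B N ε Sig₀) (scaledFinal A B N ε SigN)))
    (h : IsOptimal A B N ε Sig₀ SigN π) {k : ℕ} (hk : k < N) :
    ∀ᵐ x ∂(stateLaw A B (multivariateGaussian 0 Sig₀) π k),
      π k x =ᵐ[volume] optPolicy A B N ε Sig₀ SigN k x := by
  have hle := h.minimal _ (isFeasible_optPolicy hε hA hG h₀ h₁ hF)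
  have hc' := hasFiniteCost_optPolicy hε hA hG h₀ h₁ hF
  have hc : HasFiniteCost A B N (multivariateGaussian 0 Sig₀) π := by
    by_contra hc
    have hlt := hle.trans_lt (cost_optPolicy_lt_top hε hA hG h₀ h₁ hF)
    rw [cost, if_neg hc] at hlt
    exact lt_irrefl _ hlt
  have hrel := fun j (hj : j ∈ Finset.range N) =>
    relEnt_optPolicy hε IsGaussian.memLp_two_id h.feasible.policy hc (Finset.mem_range.1 hj)
      (gainMatrix_posDef hε hA hG h₀ h₁ hF (Finset.mem_range.1 hj))
  rw [cost, cost, if_pos hc, if_pos hc', EReal.coe_le_coe_iff,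
    total_cost_eq hε hA hG h₀ h₁ hF h.feasible hc,
    total_cost_eq hε hA hG h₀ h₁ hF (isFeasible_optPolicy hε hA hG h₀ h₁ hF) hc'] at hle
  simp only [relEnt_self, integral_zero, Finset.sum_const_zero, mul_zero, add_zero,
    add_le_iff_nonpos_right] at hle
  -- Both costs share the same constant, so optimality forces the sum of nonnegative expected
  -- relative entropies to vanish, hence each term.
  have hsum := le_antisymm (nonpos_of_mul_nonpos_right hle hε)
    (Finset.sum_nonneg fun j hj => (hrel j hj).1)
  have hk' := Finset.mem_range.2 hk
  exact (hrel k hk').2 ((Finset.sum_eq_zero_iff_of_nonneg fun j hj => (hrel j hj).1).1 hsum k hk')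

/-- Agreement of the policies at almost every visited state gives equal joint laws, hence equal next
state laws. -/
lemma IsOptimal.stateLaw_eq (hε : 0 < ε) (hA : ∀ k < N, IsUnit (A k))
    (hG : (ctrlGramian A B N 0).PosDef) (h₀ : Sig₀.PosDef) (h₁ : SigN.PosDef)
    (hF : IsUnit (calF (scaledInit A B N ε Sig₀) (scaledFinal A B N ε SigN)))
    (h : IsOptimal A B N ε Sig₀ SigN π) :
    ∀ k ≤ N, stateLaw A B (multivariateGaussian 0 Sig₀) π k =
      stateLaw A B (multivariateGaussian 0 Sig₀) (optPolicy A B N ε Sig₀ SigN) k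
  | 0, _ => rfl
  | k + 1, hk => by
    have := isProbabilityMeasure_stateLaw (A := A) (B := B) (ν := multivariateGaussian 0 Sig₀)
      h.feasible.policy k (by lia)
    rw [stateLaw, jointLaw_congr (h.feasible.policy.isCondDensity hk)
      (isCondDensity_optPolicy hε (gainMatrix_posDef hε hA hG h₀ h₁ hF hk))
      (h.ae_stateLaw_eq hε hA hG h₀ h₁ hF hk), h.stateLaw_eq hε hA hG h₀ h₁ hF k (by lia),
      stateLaw]

/-- The visited states follow a nondegenerate Gaussian law, whose null sets are Lebesgue null. -/
lemma IsOptimal.ae_eq (hε : 0 < ε) (hA : ∀ k < N, IsUnit (A k))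
    (hG : (ctrlGramian A B N 0).PosDef) (h₀ : Sig₀.PosDef) (h₁ : SigN.PosDef)
    (hF : IsUnit (calF (scaledInit A B N ε Sig₀) (scaledFinal A B N ε SigN)))
    (h : IsOptimal A B N ε Sig₀ SigN π) {k : ℕ} (hk : k < N) :
    ∀ᵐ x, π k x =ᵐ[volume] optPolicy A B N ε Sig₀ SigN k x := by
  have hae := h.ae_stateLaw_eq hε hA hG h₀ h₁ hF hk
  rw [h.stateLaw_eq hε hA hG h₀ h₁ hF k hk.le, stateLaw_optPolicy hε hA hG h₀ h₁ hF k hk.le] at hae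
  exact (volume_absolutelyContinuous_multivariateGaussian 0
    (optCov_posDef hε hA hG h₀ h₁ hF k hk.le)).ae_le hae

end Verification

end DensityControl

theorem theorem1 {n m : ℕ} (N : ℕ) (hN : 0 < N) (ε : ℝ) (hε : 0 < ε)
    (A : ℕ → Matrix (Fin n) (Fin n) ℝ) (B : ℕ → Matrix (Fin n) (Fin m) ℝ)
    (Sig₀ SigN : Matrix (Fin n) (Fin n) ℝ) (hSig₀ : Sig₀.PosDef) (hSigN : SigN.PosDef)
    (hA : ∀ k < N, IsUnit (A k))
    (hG : ∃ kr : ℕ, 1 ≤ kr ∧ kr ≤ N ∧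
      (∀ k, kr ≤ k → k ≤ N → IsUnit (DensityControl.reachGramian A B k 0)) ∧
      (∀ k, k ≤ kr - 1 → IsUnit (DensityControl.reachGramian A B N k)))
    (hF : IsUnit (DensityControl.calF (DensityControl.scaledInit A B N ε Sig₀)
      (DensityControl.scaledFinal A B N ε SigN)))
    (hB : IsUnit (DensityControl.calB (DensityControl.scaledInit A B N ε Sig₀)
      (DensityControl.scaledFinal A B N ε SigN))) :
    (∀ k ≤ N, IsUnit (DensityControl.Qminus A B N ε Sig₀ SigN k)) ∧
    (∀ k < N, (DensityControl.gainMatrix A B N ε Sig₀ SigN k).PosDef) ∧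
    DensityControl.IsOptimal A B N ε Sig₀ SigN
      (DensityControl.optPolicy A B N ε Sig₀ SigN) ∧
    DensityControl.cost A B N ε (multivariateGaussian 0 Sig₀)
      (DensityControl.optPolicy A B N ε Sig₀ SigN) < ⊤ ∧
    ∀ π : ℕ → EuclideanSpace ℝ (Fin n) → EuclideanSpace ℝ (Fin m) → ℝ,
      DensityControl.IsOptimal A B N ε Sig₀ SigN π →
        ∀ k < N, ∀ᵐ x, π k x =ᵐ[volume] DensityControl.optPolicy A B N ε Sig₀ SigN k x := by
  -- Taking `k = N` gives `G_r(N,0)` invertible, hence `G_c(N,0)` positive definite.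
  obtain ⟨kr, -, hkr, hr, -⟩ := hG
  have hGpos := DensityControl.ctrlGramian_posDef hA (hr N hkr le_rfl)
  exact ⟨fun k hk => DensityControl.Qminus_isUnit hε hA hGpos hSig₀ hSigN hF hk,
    fun k hk => DensityControl.gainMatrix_posDef hε hA hGpos hSig₀ hSigN hF hk,
    DensityControl.isOptimal_optPolicy hε hA hGpos hSig₀ hSigN hF,
    DensityControl.cost_optPolicy_lt_top hε hA hGpos hSig₀ hSigN hF,
    fun π hπ k hk => hπ.ae_eq hε hA hGpos hSig₀ hSigN hF hk⟩
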